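/- Let variables range over a countable set (here $\mathbb N$). A CNF $F$ is a finite set of non-tautological clauses, a clause being a finite set of literals; $\mathsf{var}(F)$ is the set of variables occurring in $F$, and $\mathsf{size}(F)=\sum_{c\in F}|c|$. For $f\colon V\to\{0,1\}$ let $F[f]$ be the CNF obtained from $F$ by removing the clauses satisfied by $f$ and deleting from the remaining clauses all literals on variables of $V$; let $\mathsf{st}(F,V)=\{F[f] \mid f\colon V\to\{0,1\}\}$ be the set of $V$-subterms of $F$, for $V\subseteq\mathsf{var}(F)$. For an ordering (total order) $\sigma$ of $\mathsf{var}(F)$ let $\mathsf{stw}(F,\sigma)$ be the maximum of $|\mathsf{st}(F,\mathsf{var}(\pi))|$ over the nonempty prefixes $\pi$ of $\sigma$ ($0$ if $\mathsf{var}(F)=\emptyset$), where $\mathsf{var}(\pi)$ is the set of variables ordered by $\pi$; the subterm width of $F$ is the minimum of $\mathsf{stw}(F,\sigma)$ over all orderings $\sigma$ of $\mathsf{var}(F)$. A class $\mathcal F$ of CNFs has constructive few subterms if there is a polynomial $p\colon\mathbb N\to\mathbb N$ such that every $F\in\mathcal F$ has subterm width at most $p(\mathsf{size}(F))$, and there is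 a polynomial-time algorithm that, given $F\in\mathcal F$, returns an ordering $\sigma$ of $\mathsf{var}(F)$ with $\mathsf{stw}(F,\sigma)\le p(\mathsf{size}(F))$. An ordering $\sigma$ of $\mathsf{var}(F)$ witnesses left convexity of the incidence graph of $F$ if, whenever $v<v''<v'$ in $\sigma$ and $v,v'$ occur in a clause $c\in F$, also $v''$ occurs in $c$; the CNF $F$ is variable convex if such an ordering exists. Polynomial time means time polynomial in the length of the input, which lists the clauses of $F$ and their literals with variable names written in binary. Then: (1) The class of variable convex CNFs has constructive few subterms. (2) For every CNF $F$, every ordering $\sigma$ of $\mathsf{var}(F)$ witnessing left convexity of the incidence graph of $F$, and every nonempty prefix $\pi$ of $\sigma$, $|\mathsf{st}(F,\mathsf{var}(\pi))|\le 2(\mathsf{size}(F)+1)$. (3) There is a polynomial-time algorithm that, given a variable convex CNF $F$, returns an ordering of $\mathsf{var}(F)$ witnessing left convexity of the incidence graph of $F$. -/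

import Mathlib

namespace FewSubterms

/-! ### CNF formulas

The countable set of variables is `ℕ`. -/

/-- A literal: `(x, true)` is the variable `x`, and `(x, false)` is its negation. -/
abbrev Literal := ℕ × Bool

/-- A clause is a finite set of literals. -/
abbrev Clause := Finset Literal

namespace Clause

/-- The variables of a clause. -/
def vars (c : Clause) : Finset ℕ := c.image Prod.fst

/-- A clause is tautological if it contains a literal negated as well as unnegated. -/
def Tautological (c : Clause) : Prop := ∃ x : ℕ, (x, true) ∈ c ∧ (x, false) ∈ c

/-- The assignment `f : V → {0,1}` satisfies the clause `c`, that is, makes one of its literals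
true. -/
def SatBy (c : Clause) {V : Finset ℕ} (f : V → Bool) : Prop :=
  ∃ l ∈ c, ∃ h : l.1 ∈ V, f ⟨l.1, h⟩ = l.2

/-- The clause obtained by deleting all literals on variables of `V`. -/
def delete (c : Clause) (V : Finset ℕ) : Clause := c.filter fun l => l.1 ∉ V

end Clause

/-- A CNF is a finite set of non-tautological clauses. -/
@[ext]
structure CNF where
  clauses : Finset Clause
  not_taut : ∀ c ∈ clauses, ¬ Clause.Tautological c

namespace CNF

/-- The variables of a CNF. -/
def vars (F : CNF) : Finset ℕ := F.clauses.biUnion Clause.vars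

/-- The size of a CNF is the sum of the sizes of its clauses. -/
def size (F : CNF) : ℕ := ∑ c ∈ F.clauses, c.card

open Classical in
/-- The CNF `F[f]` for an assignment `f : V → {0,1}`: the clauses of `F` that `f` does not satisfy,
without their literals on variables of `V`. -/
noncomputable def restrict (F : CNF) {V : Finset ℕ} (f : V → Bool) : CNF where
  clauses := (F.clauses.filter fun c => ¬ Clause.SatBy c f).image fun c => Clause.delete c V
  not_taut := by
    intro d hd
    obtain ⟨c, hc, rfl⟩ := Finset.mem_image.1 hd
    rintro ⟨x, h1, h2⟩
    exact F.not_taut c (Finset.mem_filter.1 hc).1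
      ⟨x, (Finset.mem_filter.1 h1).1, (Finset.mem_filter.1 h2).1⟩

/-- The set `st(F, V)` of `V`-subterms of `F`. It is finite, there being finitely many `f`. -/
def subterms (F : CNF) (V : Finset ℕ) : Set CNF :=
  {G | ∃ f : V → Bool, G = F.restrict f}

end CNF

/-! ### Orderings -/

/-- An ordering of a finite set `S`, given as the list of the elements of `S` in increasing
order. Its length `j` prefix is `σ.take j`. -/
def IsOrdering {α : Type*} [DecidableEq α] (σ : List α) (S : Finset α) : Prop :=
  σ.Nodup ∧ σ.toFinset = S

/-- `v` precedes `w` in the ordering `σ` (for elements `v`, `w` of `σ`). -/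
def Precedes {α : Type*} [DecidableEq α] (σ : List α) (v w : α) : Prop :=
  σ.idxOf v < σ.idxOf w

/-! ### Bipartite graphs and convexity -/

/-- A bipartite graph with finite blocks `left` and `right`. -/
structure BipartiteGraph (α β : Type*) where
  left : Finset α
  right : Finset β
  Adj : α → β → Prop
  left_of_adj : ∀ {v w}, Adj v w → v ∈ left
  right_of_adj : ∀ {v w}, Adj v w → w ∈ right

/-- The ordering `σ` of the left block witnesses left convexity of `G`. -/
def WitnessesLeftConvexity {α β : Type*} [DecidableEq α] (σ : List α)
    (G : BipartiteGraph α β) : Prop :=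
  IsOrdering σ G.left ∧
    ∀ w ∈ G.right, ∀ v ∈ G.left, ∀ v'' ∈ G.left, ∀ v' ∈ G.left,
      G.Adj v w → G.Adj v' w → Precedes σ v v'' → Precedes σ v'' v' → G.Adj v'' w

/-- A bipartite graph is left convex if some ordering of its left block witnesses this. -/
def LeftConvex {α β : Type*} [DecidableEq α] (G : BipartiteGraph α β) : Prop :=
  ∃ σ : List α, WitnessesLeftConvexity σ G

namespace CNF

/-- The incidence graph of `F`: variables on the left, clauses on the right, a variable being
adjacent to a clause if it occurs in the clause. -/
def inc (F : CNF) : BipartiteGraph ℕ Clause where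
  left := F.vars
  right := F.clauses
  Adj v c := v ∈ F.vars ∧ c ∈ F.clauses ∧ v ∈ Clause.vars c
  left_of_adj h := h.1
  right_of_adj h := h.2.1

/-- A CNF is variable convex if its incidence graph is left convex. -/
def VariableConvex (F : CNF) : Prop := LeftConvex F.inc

/-! ### Subterm width -/

/-- The subterm width of `F` with respect to `σ`: the maximum number of `var(π)`-subterms over the
prefixes `π` of `σ` of positive length (`0` if there are none). -/
noncomputable def stw (F : CNF) (σ : List ℕ) : ℕ :=
  (Finset.Icc 1 σ.length).sup fun j => (F.subterms (σ.take j).toFinset).ncard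

/-- The subterm width of `F`: the minimum of `stw F σ` over all orderings `σ` of `var(F)`
(a nonempty set of natural numbers). -/
noncomputable def subtermWidth (F : CNF) : ℕ :=
  sInf {k | ∃ σ : List ℕ, IsOrdering σ F.vars ∧ k = F.stw σ}

end CNF

/-- `b` is a subterm bound of the class `𝓕`. -/
def IsSubtermBound (𝓕 : Set CNF) (b : ℕ → ℕ) : Prop :=
  ∀ F ∈ 𝓕, F.subtermWidth ≤ b F.size

/-- The ordering `σ` of `var(F)` is a witness of the subterm bound `b` with respect to `F`. -/
def IsSubtermWitness (b : ℕ → ℕ) (F : CNF) (σ : List ℕ) : Prop :=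
  IsOrdering σ F.vars ∧ F.stw σ ≤ b F.size

/-! ### Polynomial time

The machine model is the language of while programs over binary trees, with a cost that charges
every elementary operation for all the data it reads and writes, so that it is polynomially
equivalent to Turing machines. -/

/-- The data of programs: binary trees. -/
inductive Tree where
  | nil : Tree
  | cons : Tree → Tree → Tree

/-- The number of nodes of a tree, leaves included. -/
def Tree.size : Tree → ℕ
  | .nil => 1
  | .cons a b => a.size + b.size + 1

/-- Programs; each maps a tree to a tree, if it halts. -/
inductive Prog where
  /-- return the input -/
  | id : Prog
  /-- return the leaf -/
  | nil : Prog
  /-- return the left subtree -/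
  | hd : Prog
  /-- return the right subtree -/
  | tl : Prog
  /-- run both programs on the input and join the results into one tree -/
  | pair : Prog → Prog → Prog
  /-- run the first program, then the second one on its result -/
  | seq : Prog → Prog → Prog
  /-- `ite c p q`: run `p` if the result of `c` on the input is not the leaf, otherwise `q` -/
  | ite : Prog → Prog → Prog → Prog
  /-- `loop c p`: as long as the result of `c` is not the leaf, replace the datum by the result
  of `p` on it -/
  | loop : Prog → Prog → Prog

/-- `Run p x y t`: the program `p` halts on input `x` with output `y`, in time `t`. The elementary
operations take time `1` plus the sizes of input and output, and control takes one more step. -/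
inductive Run : Prog → Tree → Tree → ℕ → Prop where
  | id (x : Tree) : Run .id x x (1 + x.size + x.size)
  | nil (x : Tree) : Run .nil x .nil (1 + x.size + Tree.nil.size)
  | hd_nil : Run .hd .nil .nil (1 + Tree.nil.size + Tree.nil.size)
  | hd_cons (a b : Tree) : Run .hd (.cons a b) a (1 + (Tree.cons a b).size + a.size)
  | tl_nil : Run .tl .nil .nil (1 + Tree.nil.size + Tree.nil.size)
  | tl_cons (a b : Tree) : Run .tl (.cons a b) b (1 + (Tree.cons a b).size + b.size)
  | pair {p q : Prog} {x y z : Tree} {s t : ℕ} :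
      Run p x y s → Run q x z t → Run (.pair p q) x (.cons y z) (s + t + 1)
  | seq {p q : Prog} {x y z : Tree} {s t : ℕ} :
      Run p x y s → Run q y z t → Run (.seq p q) x z (s + t + 1)
  | ite_true {c p q : Prog} {x a b y : Tree} {s t : ℕ} :
      Run c x (.cons a b) s → Run p x y t → Run (.ite c p q) x y (s + t + 1)
  | ite_false {c p q : Prog} {x y : Tree} {s t : ℕ} :
      Run c x .nil s → Run q x y t → Run (.ite c p q) x y (s + t + 1)
  | loop_stop {c p : Prog} {x : Tree} {s : ℕ} :
      Run c x .nil s → Run (.loop c p) x x (s + x.size + 1)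
  | loop_step {c p : Prog} {x a b y z : Tree} {s t u : ℕ} :
      Run c x (.cons a b) s → Run p x y t → Run (.loop c p) y z u →
        Run (.loop c p) x z (s + t + u + 1)

/-! Encodings by trees; variable names are written in binary. -/

def encodeList {α : Type*} (e : α → Tree) : List α → Tree
  | [] => .nil
  | a :: l => .cons (e a) (encodeList e l)

def encodeBool : Bool → Tree
  | false => .nil
  | true => .cons .nil .nil

def encodeNat (n : ℕ) : Tree := encodeList encodeBool n.bits

def encodeLiteral (l : Literal) : Tree := .cons (encodeNat l.1) (encodeBool l.2)

/-- A CNF is given to a program as a list of lists of literals. -/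
def encodeFormula (L : List (List Literal)) : Tree := encodeList (encodeList encodeLiteral) L

/-- The ordering `σ` of variables, as a tree. -/
def encodeOrdering (σ : List ℕ) : Tree := encodeList encodeNat σ

/-- `L` lists the clauses of `F`, in any order, each as a list of its literals, in any order. -/
def Represents (L : List (List Literal)) (F : CNF) : Prop :=
  (L.map List.toFinset).toFinset = F.clauses

/-- There is a polynomial time algorithm that, given a CNF `F ∈ 𝓕`, returns a list `σ` of variables
with `R F σ`. -/
def PolyTimeOrdering (𝓕 : Set CNF) (R : CNF → List ℕ → Prop) : Prop :=
  ∃ (P : Prog) (q : Polynomial ℕ), ∀ F ∈ 𝓕, ∀ L : List (List Literal), Represents L F →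
    ∃ (σ : List ℕ) (t : ℕ), R F σ ∧ Run P (encodeFormula L) (encodeOrdering σ) t ∧
      t ≤ q.eval (encodeFormula L).size

/-! ### The few subterms property -/

/-- The class `𝓕` has few subterms: it has a polynomial subterm bound. -/
def HasFewSubterms (𝓕 : Set CNF) : Prop :=
  ∃ p : Polynomial ℕ, IsSubtermBound 𝓕 fun n => p.eval n

/-- The class `𝓕` has constructive few subterms: it has a polynomial subterm bound, and for
`F ∈ 𝓕` an ordering witnessing this bound can be computed in polynomial time. -/
def HasConstructiveFewSubterms (𝓕 : Set CNF) : Prop :=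
  ∃ p : Polynomial ℕ, IsSubtermBound 𝓕 (fun n => p.eval n) ∧
    PolyTimeOrdering 𝓕 (IsSubtermWitness fun n => p.eval n)

end FewSubterms

open FewSubterms

/-!
**The bound.** Let `X` be the set of variables of a prefix of a convex ordering of the variables
of `F`. A clause without variables in `X` is the same in all subterms `F[f]`, and a clause with all
its variables in `X` contributes at most the empty clause. A clause with variables inside and
outside of `X` meets `X` in a suffix of the prefix, so the traces of these clauses on `X` are nested
(`CNF.trace_subset_of_card_le`). If `f` and `g` both fail to satisfy a clause `c`, they agree on the
trace of `c`, hence on all smaller traces. So `F[f]` is determined by an unsatisfied clause of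
maximal trace, if there is one, and by whether some clause within `X` is unsatisfied
(`CNF.ncard_subterms_le`).

**The ordering.** A linear order makes a set `S` an interval if and only if, for `a`, `b` in `S` and
`c` not in `S`, it contains both or none of `(a, c)` and `(b, c)`. Joining such pairs, and likewise
`(c, a)` and `(c, b)`, by edges gives a graph on ordered pairs; an order that makes all clauses
intervals contains each connected component or is disjoint from it. Conversely, choose from each
component and its reversal the one that contains the lexicographically first pair, with respect to
an arbitrary enumeration of the variables. The resulting tournament has no cyclic triple `x, y, z`:
in such a triple, no two members are connected by clauses that avoid the third one, so the
components `A`, `B`, `C` of the members are disjoint, the pairs `(x, y)`, `(y, z)`, `(z, x)` have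
their classes within `A × B`, `B × C`, `C × A` (`IsOrientation.implies_of_isCyclic`), and these
classes are oriented away from the component that is met first by the enumeration, which excludes
the cyclic orientation (`not_isCyclic_before`). So the tournament is a linear order, and it makes
all clauses intervals (`convexOrdering_spec`).

**Polynomial time.** The functions computed by programs in polynomial time are closed under
composition, case distinction, and folds over lists whose steps increase the size of the value by an
amount independent of this value (`PolyTime.foldl`). The tournament is built from such folds: the
components by successively merging classes of pairs, the order by insertion sort.
-/

namespace FewSubterms

/-! ### Polynomial time functions -/

open Polynomial in
/-- The program `p` halts on `x` with result `y`, within the time that the polynomial `q` allows for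
the size of `x`. -/
def RunsIn (p : Prog) (q : ℕ[X]) (x y : Tree) : Prop :=
  ∃ t, Run p x y t ∧ t ≤ q.eval x.size

/-- Polynomials over `ℕ` have nonnegative coefficients, so all of them are monotone. -/
theorem eval_mono (q : Polynomial ℕ) {m n : ℕ} (h : m ≤ n) : q.eval m ≤ q.eval n := by
  simp only [Polynomial.eval_eq_sum, Polynomial.sum]
  gcongr

/-- Writing the result takes time, so its size is bounded by the running time. -/
theorem Run.size_le {p : Prog} {x y : Tree} {t : ℕ} (h : Run p x y t) : y.size ≤ t := by
  induction h <;> (try simp only [Tree.size] at *) <;> omega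

theorem RunsIn.size_le {p : Prog} {q : Polynomial ℕ} {x y : Tree} (h : RunsIn p q x y) :
    y.size ≤ q.eval x.size :=
  let ⟨_, h, ht⟩ := h
  h.size_le.trans ht

namespace RunsIn

open Polynomial

variable {p p' : Prog} {q q' : ℕ[X]} {x y z : Tree}

theorem id (x : Tree) : RunsIn .id (1 + X + X) x x :=
  ⟨_, .id x, by simp⟩

theorem nil (x : Tree) : RunsIn .nil (2 + X) x .nil :=
  ⟨_, .nil x, by
    simp only [Tree.size, Polynomial.eval_add, Polynomial.eval_X, Polynomial.eval_ofNat]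
    omega⟩

theorem hd (a b : Tree) : RunsIn .hd (1 + X + X) (.cons a b) a :=
  ⟨_, .hd_cons a b, by simp [Tree.size]; omega⟩

theorem tl (a b : Tree) : RunsIn .tl (1 + X + X) (.cons a b) b :=
  ⟨_, .tl_cons a b, by simp [Tree.size]; omega⟩

theorem pair (h : RunsIn p q x y) (h' : RunsIn p' q' x z) :
    RunsIn (.pair p p') (q + q' + 1) x (.cons y z) := by
  obtain ⟨s, h, hs⟩ := h
  obtain ⟨t, h', ht⟩ := h'
  exact ⟨_, .pair h h', by simp; omega⟩

theorem seq (h : RunsIn p q x y) (h' : RunsIn p' q' y z) :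
    RunsIn (.seq p p') (q + q'.comp q + 1) x z := by
  have hm := eval_mono q' h.size_le
  obtain ⟨s, h, hs⟩ := h
  obtain ⟨t, h', ht⟩ := h'
  exact ⟨_, .seq h h', by simp; omega⟩

theorem ite_true {c : Prog} {r : ℕ[X]} {a b : Tree} (hc : RunsIn c r x (.cons a b))
    (h : RunsIn p q x y) : RunsIn (.ite c p p') (r + q + q' + 1) x y := by
  obtain ⟨s, hc, hs⟩ := hc
  obtain ⟨t, h, ht⟩ := h
  exact ⟨_, .ite_true hc h, by simp; omega⟩

theorem ite_false {c : Prog} {r : ℕ[X]} (hc : RunsIn c r x .nil)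
    (h : RunsIn p' q' x y) : RunsIn (.ite c p p') (r + q + q' + 1) x y := by
  obtain ⟨s, hc, hs⟩ := hc
  obtain ⟨t, h, ht⟩ := h
  exact ⟨_, .ite_false hc h, by simp; omega⟩

end RunsIn

/-- A type whose elements are written as trees. Numbers, truth values, pairs and lists are written
as in the encoding of formulas and orderings. -/
class Coded (α : Type*) where
  toTree : α → Tree

/-- The tree that `a` is written as. -/
abbrev code {α : Type*} [Coded α] (a : α) : Tree := Coded.toTree a

instance : Coded Bool := ⟨encodeBool⟩
instance : Coded ℕ := ⟨encodeNat⟩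
instance {α β : Type*} [Coded α] [Coded β] : Coded (α × β) := ⟨fun a => .cons (code a.1) (code a.2)⟩
instance {α : Type*} [Coded α] : Coded (List α) := ⟨encodeList Coded.toTree⟩

/-- The size of the code of `a`. -/
def codeSize {α : Type*} [Coded α] (a : α) : ℕ := (code a).size

/-- `f` is computed on codes by a program, in time bounded by a polynomial in the size of the code
of the argument. -/
def PolyTime {α β : Type*} [Coded α] [Coded β] (f : α → β) : Prop :=
  ∃ (p : Prog) (q : Polynomial ℕ), ∀ a, RunsIn p q (code a) (code (f a))

section codeSize

variable {α β : Type*} [Coded α] [Coded β]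

theorem codeSize_pair (a : α) (b : β) : codeSize (a, b) = codeSize a + codeSize b + 1 := rfl

theorem codeSize_nil : codeSize ([] : List α) = 1 := rfl

theorem codeSize_cons (a : α) (l : List α) : codeSize (a :: l) = codeSize a + codeSize l + 1 := rfl

theorem codeSize_append (l m : List α) : codeSize (l ++ m) + 1 = codeSize l + codeSize m := by
  induction l with
  | nil => simp [codeSize_nil, add_comm]
  | cons a l ih => simp only [List.cons_append, codeSize_cons]; omega

theorem one_le_codeSize (a : α) : 1 ≤ codeSize a := by
  unfold codeSize
  cases code a <;> simp [Tree.size]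

theorem codeSize_bool_le (b : Bool) : codeSize b ≤ 3 := by
  cases b
  · exact show 1 ≤ 3 by norm_num
  · exact le_rfl

theorem codeSize_le_of_mem {a : α} {l : List α} (h : a ∈ l) : codeSize a ≤ codeSize l := by
  induction l with
  | nil => simp at h
  | cons b l ih =>
    rw [codeSize_cons]
    rcases List.mem_cons.1 h with rfl | h
    · omega
    · have := ih h
      omega

theorem length_le_codeSize (l : List α) : l.length ≤ codeSize l := by
  induction l with
  | nil => simp
  | cons b l ih => rw [codeSize_cons, List.length_cons]; omega

end codeSize

namespace PolyTime

variable {α β γ δ σ : Type*} [Coded α] [Coded β] [Coded γ] [Coded δ] [Coded σ]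

theorem codeSize_le {f : α → β} (hf : PolyTime f) :
    ∃ q : Polynomial ℕ, ∀ a, codeSize (f a) ≤ q.eval (codeSize a) :=
  let ⟨_, q, h⟩ := hf
  ⟨q, fun a => (h a).size_le⟩

theorem id : PolyTime fun a : α => a := ⟨_, _, fun _ => .id _⟩

theorem comp {g : β → γ} {f : α → β} (hg : PolyTime g) (hf : PolyTime f) :
    PolyTime fun a => g (f a) :=
  let ⟨_, _, hg⟩ := hg
  let ⟨_, _, hf⟩ := hf
  ⟨_, _, fun a => (hf a).seq (hg _)⟩

theorem pair {f : α → β} {g : α → γ} (hf : PolyTime f) (hg : PolyTime g) :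
    PolyTime fun a => (f a, g a) :=
  let ⟨_, _, hf⟩ := hf
  let ⟨_, _, hg⟩ := hg
  ⟨_, _, fun a => (hf a).pair (hg a)⟩

theorem fst {f : α → β × γ} (hf : PolyTime f) : PolyTime fun a => (f a).1 :=
  comp (g := Prod.fst) ⟨_, _, fun _ => .hd _ _⟩ hf

theorem snd {f : α → β × γ} (hf : PolyTime f) : PolyTime fun a => (f a).2 :=
  comp (g := Prod.snd) ⟨_, _, fun _ => .tl _ _⟩ hf

theorem nil : PolyTime fun _ : α => ([] : List β) := ⟨_, _, fun _ => .nil _⟩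

theorem cons {f : α → β} {g : α → List β} (hf : PolyTime f) (hg : PolyTime g) :
    PolyTime fun a => f a :: g a :=
  let ⟨p, q, h⟩ := hf.pair hg
  ⟨p, q, h⟩

theorem const_false : PolyTime fun _ : α => false := ⟨_, _, fun _ => .nil _⟩

theorem const_true : PolyTime fun _ : α => true := ⟨_, _, fun _ => (RunsIn.nil _).pair (.nil _)⟩

theorem ite {c : α → Bool} {f g : α → β} (hc : PolyTime c) (hf : PolyTime f) (hg : PolyTime g) :
    PolyTime fun a => if c a then f a else g a := by
  obtain ⟨pc, qc, hc⟩ := hc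
  obtain ⟨pf, qf, hf⟩ := hf
  obtain ⟨pg, qg, hg⟩ := hg
  refine ⟨.ite pc pf pg, qc + qf + qg + 1, fun a => ?_⟩
  have h := hc a
  by_cases ha : c a
  · rw [ha] at h
    simpa only [ha, if_true] using RunsIn.ite_true h (hf a)
  · rw [Bool.eq_false_of_not_eq_true ha] at h
    simpa only [ha, Bool.false_eq_true, if_false] using RunsIn.ite_false h (hg a)

theorem and {c d : α → Bool} (hc : PolyTime c) (hd : PolyTime d) :
    PolyTime fun a => c a && d a := by
  convert hc.ite hd const_false using 2 with a
  cases c a <;> rfl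

theorem or {c d : α → Bool} (hc : PolyTime c) (hd : PolyTime d) :
    PolyTime fun a => c a || d a := by
  convert hc.ite const_true hd using 2 with a
  cases c a <;> rfl

theorem not {c : α → Bool} (hc : PolyTime c) : PolyTime fun a => !c a := by
  convert hc.ite const_false const_true using 2 with a
  cases c a <;> rfl

/-- Case distinction on a list. -/
theorem listCases {l : α → List β} {f : α → γ} {g : α → β → List β → γ} (hl : PolyTime l)
    (hf : PolyTime f) (hg : PolyTime fun p : α × β × List β => g p.1 p.2.1 p.2.2) :
    PolyTime fun a => match l a with
      | [] => f a
      | x :: xs => g a x xs := by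
  obtain ⟨pl, ql, hl⟩ := hl
  obtain ⟨pf, qf, hf⟩ := hf
  obtain ⟨pg, qg, hg⟩ := hg
  refine ⟨.ite pl (.seq (.pair .id pl) pg) pf,
    ql + ((1 + .X + .X + ql + 1) + qg.comp (1 + .X + .X + ql + 1) + 1) + qf + 1, fun a => ?_⟩
  have h := hl a
  rcases hla : l a with _ | ⟨x, xs⟩
  · rw [hla] at h
    simp only [hla]
    exact RunsIn.ite_false h (hf a)
  · rw [hla] at h
    simp only [hla]
    exact RunsIn.ite_true h (((RunsIn.id _).pair h).seq (hg (a, x, xs)))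

/-- The loop computing a fold: its state consists of the context `c`, the elements of the list not
yet treated, and the value `s` of the fold so far. If all states have size at most `M` then the time
is bounded in terms of `M`. -/
theorem exists_run_loop {g : γ → σ → α → σ}
    (hg : PolyTime fun p : (γ × σ) × α => g p.1.1 p.1.2 p.2) :
    ∃ (p : Prog) (q : Polynomial ℕ), ∀ (M : ℕ) (c : γ) (l : List α) (s : σ),
      (∀ l' l'', l = l' ++ l'' → codeSize ((c, l''), l'.foldl (g c) s) ≤ M) →
        ∃ t, Run p (code ((c, l), s)) (code ((c, ([] : List α)), l.foldl (g c) s)) t ∧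
          t ≤ (l.length + 1) * q.eval M := by
  obtain ⟨pg, qg, hg⟩ := hg
  obtain ⟨p₁, q₁, h₁⟩ : PolyTime fun p : (γ × List α) × σ => p.1.2 := id.fst.snd
  obtain ⟨p₂, q₂, h₂⟩ : ∃ (p : Prog) (q : Polynomial ℕ), ∀ (c : γ) (x : α) (l : List α) (s : σ),
      RunsIn p q (code ((c, x :: l), s)) (code ((c, l), g c s x)) :=
    ⟨_, _, fun c x l s =>
      ((((RunsIn.hd _ _).seq (.hd _ _)).pair (((RunsIn.hd _ _).seq (.tl _ _)).seq (.tl _ _))).pair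
        (((((RunsIn.hd _ _).seq (.hd _ _)).pair (.tl _ _)).pair
          (((RunsIn.hd _ _).seq (.tl _ _)).seq (.hd _ _))).seq (hg ((c, s), x))))⟩
  refine ⟨.loop p₁ p₂, q₁ + q₂ + .X + 1, fun M c l => ?_⟩
  induction l with
  | nil =>
    intro s hM
    obtain ⟨t, h, ht⟩ := h₁ ((c, []), s)
    refine ⟨_, Run.loop_stop h, ?_⟩
    have hs : codeSize ((c, ([] : List α)), s) ≤ M := hM [] [] rfl
    have := eval_mono q₁ hs
    simp only [codeSize] at hs this
    simp
    omega
  | cons x l ih =>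
    intro s hM
    obtain ⟨t, h, ht⟩ := h₁ ((c, x :: l), s)
    obtain ⟨u, h', hu⟩ := h₂ c x l s
    obtain ⟨v, h'', hv⟩ := ih (g c s x) fun l' l'' e => hM (x :: l') l'' (by simp [e])
    refine ⟨_, .loop_step h h' h'', ?_⟩
    have hs : codeSize ((c, x :: l), s) ≤ M := hM [] _ rfl
    have e₁ := eval_mono q₁ hs
    have e₂ := eval_mono q₂ hs
    simp only [codeSize] at hs e₁ e₂
    simp only [Polynomial.eval_add, Polynomial.eval_X, Polynomial.eval_one, List.length_cons]
      at hv ⊢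
    rw [add_mul _ 1, one_mul]
    omega

/-- A fold is computed in polynomial time if each step is, and increases the size of the value
by an amount that does not depend on the value. -/
theorem foldl {l : γ → List α} {i : γ → σ} {g : γ → σ → α → σ} (hl : PolyTime l) (hi : PolyTime i)
    (hg : PolyTime fun p : (γ × σ) × α => g p.1.1 p.1.2 p.2) (r : Polynomial ℕ)
    (hr : ∀ c s x, codeSize (g c s x) ≤ codeSize s + r.eval (codeSize (c, x))) :
    PolyTime fun c => (l c).foldl (g c) (i c) := by
  obtain ⟨p, q, hp⟩ := exists_run_loop hg
  obtain ⟨ql, hql⟩ := hl.codeSize_le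
  obtain ⟨qi, hqi⟩ := hi.codeSize_le
  have h₀ : PolyTime fun c => ((c, l c), i c) := (id.pair hl).pair hi
  obtain ⟨p₀, q₀, h₀⟩ := h₀
  -- a bound on the sizes of all states of the loop
  let B : Polynomial ℕ := .X + ql + (qi + ql * r.comp (.X + ql + 1)) + 2
  have key : ∀ c, RunsIn (.seq p₀ p)
      (q₀ + (ql + 1) * q.comp B + 1) (code c)
      (code ((c, ([] : List α)), (l c).foldl (g c) (i c))) := by
    intro c
    have grow : ∀ (l' : List α) (s : σ), (∀ x ∈ l', x ∈ l c) → codeSize (l'.foldl (g c) s) ≤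
        codeSize s + l'.length * r.eval (codeSize c + ql.eval (codeSize c) + 1) := by
      intro l'
      induction l' with
      | nil => intro s _; simp
      | cons x l' ih =>
        intro s hx
        have e₁ := ih (g c s x) fun y hy => hx y (by simp [hy])
        have e₂ := hr c s x
        have e₃ : r.eval (codeSize (c, x)) ≤ r.eval (codeSize c + ql.eval (codeSize c) + 1) := by
          apply eval_mono
          rw [codeSize_pair]
          have := codeSize_le_of_mem (hx x (by simp))
          have := hql c
          omega
        rw [List.foldl_cons, List.length_cons, add_mul, one_mul]
        omega
    obtain ⟨t, h, ht⟩ := hp (B.eval (codeSize c)) c (l c) (i c) (by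
      intro l' l'' e
      have e₁ := grow l' (i c) (by simp [e]; tauto)
      have e₂ : codeSize l'' ≤ codeSize (l c) := by
        have := codeSize_append l' l''
        have := one_le_codeSize l'
        rw [e]
        omega
      have e₃ := hql c
      have e₄ : l'.length ≤ ql.eval (codeSize c) := by
        refine le_trans ?_ e₃
        refine le_trans ?_ (length_le_codeSize _)
        simp [e]
      have e₅ := Nat.mul_le_mul_right (r.eval (codeSize c + ql.eval (codeSize c) + 1)) e₄
      have e₆ := hqi c
      rw [codeSize_pair, codeSize_pair]
      simp [B]
      omega)
    obtain ⟨u, h', hu⟩ := h₀ c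
    refine ⟨_, .seq h' h, ?_⟩
    have e : (l c).length + 1 ≤ ql.eval (codeSize c) + 1 :=
      Nat.succ_le_succ ((length_le_codeSize _).trans (hql c))
    have e' := ht.trans (Nat.mul_le_mul_right _ e)
    simp only [Polynomial.eval_add, Polynomial.eval_mul, Polynomial.eval_comp, Polynomial.eval_one]
    unfold codeSize at e'
    omega
  exact ⟨.seq (.seq p₀ p) .tl, _, fun c => (key c).seq (.tl _ _)⟩

theorem reverse {l : γ → List α} (hl : PolyTime l) : PolyTime fun c => (l c).reverse := by
  have h := hl.foldl (i := fun _ => []) (g := fun _ s x => x :: s) nil (id.snd.cons id.fst.snd)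
    (.X + 1) (fun c s x => by simp [codeSize_cons, codeSize_pair]; omega)
  convert h using 2
  simp

/-- Reversing the first list turns the right fold of `List.append` into a left fold. -/
theorem append {l m : γ → List α} (hl : PolyTime l) (hm : PolyTime m) :
    PolyTime fun c => l c ++ m c := by
  have h := hl.reverse.foldl (g := fun _ s x => x :: s) hm (id.snd.cons id.fst.snd)
    (.X + 1) (fun c s x => by simp [codeSize_cons, codeSize_pair]; omega)
  convert h using 2
  simp

theorem flatMap {l : γ → List α} {f : γ → α → List β} (hl : PolyTime l)
    (hf : PolyTime fun p : γ × α => f p.1 p.2) : PolyTime fun c => (l c).flatMap (f c) := by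
  obtain ⟨q, hq⟩ := hf.codeSize_le
  have hf' : PolyTime fun p : (γ × List β) × α => f p.1.1 p.2 := hf.comp (id.fst.fst.pair id.snd)
  have h := hl.foldl (i := fun _ => []) (g := fun c s x => s ++ f c x) nil (id.fst.snd.append hf') q
    (fun c s x => by
      have := codeSize_append s (f c x)
      have := hq (c, x)
      simp only at this
      omega)
  convert h using 2
  rename_i c
  rw [List.flatMap_eq_foldl]

theorem map {l : γ → List α} {f : γ → α → β} (hl : PolyTime l)
    (hf : PolyTime fun p : γ × α => f p.1 p.2) : PolyTime fun c => (l c).map (f c) := by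
  convert hl.flatMap (f := fun c x => [f c x]) (hf.cons nil) using 2
  rw [List.map_eq_flatMap]

theorem flatten {l : γ → List (List α)} (hl : PolyTime l) : PolyTime fun c => (l c).flatten := by
  convert hl.flatMap (f := fun _ x => x) id.snd using 2
  simp [List.flatMap]

theorem filter {l : γ → List α} {f : γ → α → Bool} (hl : PolyTime l)
    (hf : PolyTime fun p : γ × α => f p.1 p.2) : PolyTime fun c => (l c).filter (f c) := by
  convert hl.flatMap (f := fun c x => if f c x then [x] else []) (hf.ite (id.snd.cons nil) nil)
    using 2 with c
  induction l c with
  | nil => rfl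
  | cons x l ih => by_cases h : f c x <;> simp [h, ih]

theorem any {l : γ → List α} {f : γ → α → Bool} (hl : PolyTime l)
    (hf : PolyTime fun p : γ × α => f p.1 p.2) : PolyTime fun c => (l c).any (f c) := by
  convert (hl.filter hf).listCases (f := fun _ => false) (g := fun _ _ _ => true) const_false
    const_true using 2 with c
  induction l c with
  | nil => rfl
  | cons x l ih => by_cases h : f c x <;> simp [h, ih]

theorem decide_eq_bool {f g : γ → Bool} (hf : PolyTime f) (hg : PolyTime g) :
    PolyTime fun c => decide (f c = g c) := by
  convert hf.ite hg hg.not using 2 with c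
  cases f c <;> cases g c <;> rfl

/-- Bit strings are compared by a fold over the first one, whose value consists of what remains of
the second one and whether the bits seen so far agree. -/
theorem decide_eq_bits {f g : γ → List Bool} (hf : PolyTime f) (hg : PolyTime g) :
    PolyTime fun c => decide (f c = g c) := by
  let step : List Bool × Bool → Bool → List Bool × Bool := fun s x =>
    match s.1 with
    | [] => ([], false)
    | y :: ys => (ys, s.2 && decide (x = y))
  have hstep : PolyTime fun p : (γ × List Bool × Bool) × Bool => step p.1.2 p.2 := by
    convert listCases (α := (γ × List Bool × Bool) × Bool) (f := fun _ => ([], false))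
      (g := fun p y ys => (ys, p.1.2.2 && decide (p.2 = y))) id.fst.snd.fst (nil.pair const_false)
      (id.snd.snd.pair (id.fst.fst.snd.snd.and (id.fst.snd.decide_eq_bool id.snd.fst)))
      using 2 with p
    rcases p with ⟨⟨_, _ | ⟨_, _⟩, _⟩, _⟩ <;> rfl
  have h := hf.foldl (g := fun _ => step) (hg.pair const_true) hstep 3 (by
    rintro c ⟨_ | ⟨y, ys⟩, b⟩ x
    · simp only [step, codeSize_pair, codeSize_nil]
      have := codeSize_bool_le false
      simp
      omega
    · simp only [step, codeSize_pair, codeSize_cons]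
      have := codeSize_bool_le (b && decide (x = y))
      simp
      omega)
  have key : ∀ (l m : List Bool) (b : Bool), decide (l = m ∧ b = true) =
      match l.foldl step (m, b) with
      | ([], b') => b'
      | (_ :: _, _) => false := by
    -- once a difference is recorded, it stays recorded
    have bad : ∀ (l m : List Bool), (l.foldl step (m, false)).2 = false := by
      intro l
      induction l with
      | nil => intro m; rfl
      | cons x l ih => rintro (_ | ⟨y, m⟩) <;> simp [step, ih]
    intro l
    induction l with
    | nil => rintro (_ | ⟨y, m⟩) b <;> simp
    | cons x l ih =>
      rintro (_ | ⟨y, m⟩) b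
      · have := bad l []
        rw [List.foldl_cons]
        simp only [step] at this ⊢
        rcases h : List.foldl _ _ l with ⟨_ | ⟨y, m⟩, b⟩
        · rw [h] at this
          simp_all
        · simp
      · rw [List.foldl_cons]
        change _ = match l.foldl step (m, b && decide (x = y)) with
          | ([], b') => b'
          | (_ :: _, _) => false
        rw [← ih]
        cases b <;> simp [Bool.and_comm]
  convert (h.fst.listCases (f := fun c => ((f c).foldl step (g c, true)).2)
    (g := fun _ _ _ => false) h.snd const_false) using 2 with c
  have := key (f c) (g c) true
  rw [show decide (f c = g c) = decide (f c = g c ∧ true = true) by simp, this]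
  rcases (f c).foldl step (g c, true) with ⟨_ | ⟨y, m⟩, b⟩ <;> rfl

theorem decide_eq_nat {f g : γ → ℕ} (hf : PolyTime f) (hg : PolyTime g) :
    PolyTime fun c => decide (f c = g c) := by
  -- a number and the list of its bits have the same code
  have h : PolyTime Nat.bits := ⟨_, _, fun _ => .id _⟩
  convert (h.comp hf).decide_eq_bits (h.comp hg) using 3
  refine ⟨congrArg _, fun h => (Nat.digits_inj_iff (b := 2)).1 ?_⟩
  simp only [Nat.digits_two_eq_bits, h]

theorem decide_eq_pair {f g : γ → ℕ × ℕ} (hf : PolyTime f) (hg : PolyTime g) :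
    PolyTime fun c => decide (f c = g c) := by
  convert (hf.fst.decide_eq_nat hg.fst).and (hf.snd.decide_eq_nat hg.snd) using 2
  simp [Prod.ext_iff]

theorem decide_mem [DecidableEq α]
    (h : PolyTime fun p : α × α => decide (p.1 = p.2)) {f : γ → α} {l : γ → List α}
    (hf : PolyTime f) (hl : PolyTime l) : PolyTime fun c => decide (f c ∈ l c) := by
  convert hl.any (f := fun c x => decide (f c = x)) (h.comp ((hf.comp id.fst).pair id.snd)) using 2
    with c
  simp [List.any_eq]

end PolyTime

/-! ### Implication classes of ordered pairs -/

section Forcing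

variable {α : Type*}

/-- Adjacency of the implication graph of the set family `𝓢`, whose vertices are ordered pairs of
elements of the ground set `⋃₀ 𝓢`: if `a`, `b` lie in a member of `𝓢` and `c` does not, then in an
ordering in which this member is an interval, `a` precedes `c` if and only if `b` does. -/
inductive Forces (𝓢 : Set (Set α)) : α × α → α × α → Prop
  | left {S : Set α} {a b c : α} : S ∈ 𝓢 → a ∈ S → b ∈ S → c ∈ ⋃₀ 𝓢 → c ∉ S →
      Forces 𝓢 (a, c) (b, c)
  | right {S : Set α} {a b c : α} : S ∈ 𝓢 → a ∈ S → b ∈ S → c ∈ ⋃₀ 𝓢 → c ∉ S →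
      Forces 𝓢 (c, a) (c, b)

/-- The two ordered pairs lie in the same connected component of the implication graph. -/
abbrev Implies (𝓢 : Set (Set α)) : α × α → α × α → Prop :=
  Relation.ReflTransGen (Forces 𝓢)

/-- `a` and `b` are connected by members of `𝓢` that avoid `c`. -/
abbrev ConnAvoiding (𝓢 : Set (Set α)) (c a b : α) : Prop :=
  Relation.ReflTransGen (fun a b => ∃ S ∈ 𝓢, a ∈ S ∧ b ∈ S ∧ c ∉ S) a b

variable {𝓢 : Set (Set α)}

theorem Forces.symm {p q : α × α} (h : Forces 𝓢 p q) : Forces 𝓢 q p := by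
  cases h with
  | left hS ha hb hc hc' => exact .left hS hb ha hc hc'
  | right hS ha hb hc hc' => exact .right hS hb ha hc hc'

theorem Forces.swap {p q : α × α} (h : Forces 𝓢 p q) : Forces 𝓢 p.swap q.swap := by
  cases h with
  | left hS ha hb hc hc' => exact .right hS ha hb hc hc'
  | right hS ha hb hc hc' => exact .left hS ha hb hc hc'

theorem Implies.symm {p q : α × α} (h : Implies 𝓢 p q) : Implies 𝓢 q p :=
  haveI : Std.Symm (Forces 𝓢) := ⟨fun _ _ => Forces.symm⟩
  Std.Symm.symm _ _ h

theorem Implies.swap {p q : α × α} (h : Implies 𝓢 p q) : Implies 𝓢 p.swap q.swap :=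
  Relation.ReflTransGen.lift Prod.swap (fun _ _ h => Forces.swap h) _ _ h

theorem Forces.mem_and_ne {p q : α × α} (h : Forces 𝓢 p q) :
    p.1 ∈ ⋃₀ 𝓢 ∧ p.2 ∈ ⋃₀ 𝓢 ∧ p.1 ≠ p.2 := by
  cases h with
  | left hS ha hb hc hc' => exact ⟨⟨_, hS, ha⟩, hc, ne_of_mem_of_not_mem ha hc'⟩
  | right hS ha hb hc hc' => exact ⟨hc, ⟨_, hS, ha⟩, (ne_of_mem_of_not_mem ha hc').symm⟩

theorem Implies.eq_or_mem_and_ne {p q : α × α} (h : Implies 𝓢 p q) :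
    p = q ∨ p.1 ∈ ⋃₀ 𝓢 ∧ p.2 ∈ ⋃₀ 𝓢 ∧ p.1 ≠ p.2 := by
  rcases Relation.ReflTransGen.cases_head h with h | ⟨_, h, _⟩
  · exact .inl h
  · exact .inr h.mem_and_ne

theorem Implies.fst_eq_snd {p q : α × α} (h : Implies 𝓢 p q) (hp : p.1 = p.2) : q.1 = q.2 := by
  rcases h.eq_or_mem_and_ne with rfl | h
  · exact hp
  · exact absurd hp h.2.2

theorem ConnAvoiding.symm {a b c : α} (h : ConnAvoiding 𝓢 c a b) : ConnAvoiding 𝓢 c b a :=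
  haveI : Std.Symm fun a b => ∃ S ∈ 𝓢, a ∈ S ∧ b ∈ S ∧ c ∉ S :=
    ⟨fun _ _ ⟨S, hS, ha, hb, hc⟩ => ⟨S, hS, hb, ha, hc⟩⟩
  Std.Symm.symm _ _ h

theorem ConnAvoiding.implies_left {a b c : α} (h : ConnAvoiding 𝓢 c a b) (hc' : c ∈ ⋃₀ 𝓢) :
    Implies 𝓢 (a, c) (b, c) :=
  Relation.ReflTransGen.lift (fun a => (a, c))
    (fun _ _ ⟨_, hS, ha, hb, hc⟩ => Forces.left hS ha hb hc' hc) _ _ h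

theorem ConnAvoiding.implies_right {a b c : α} (h : ConnAvoiding 𝓢 c a b) (hc' : c ∈ ⋃₀ 𝓢) :
    Implies 𝓢 (c, a) (c, b) :=
  (h.implies_left hc').swap

/-- A relation that respects the implication graph and contains no pair together with its
reversal. -/
structure IsOrientation (𝓢 : Set (Set α)) (R : α → α → Prop) : Prop where
  congr : ∀ {a b c d}, Implies 𝓢 (a, b) (c, d) → R a b → R c d
  asymm : ∀ {a b}, R a b → ¬ R b a

/-- A cyclic triple of elements of the ground set `⋃₀ 𝓢`. -/
structure IsCyclic (𝓢 : Set (Set α)) (R : α → α → Prop) (x y z : α) : Prop where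
  mem_x : x ∈ ⋃₀ 𝓢
  mem_y : y ∈ ⋃₀ 𝓢
  mem_z : z ∈ ⋃₀ 𝓢
  xy : R x y
  yz : R y z
  zx : R z x

theorem IsCyclic.rotate {R : α → α → Prop} {x y z : α} (h : IsCyclic 𝓢 R x y z) :
    IsCyclic 𝓢 R y z x := ⟨h.mem_y, h.mem_z, h.mem_x, h.yz, h.zx, h.xy⟩

namespace IsOrientation

variable {R : α → α → Prop} {x y z : α}

theorem not_connAvoiding_left (hR : IsOrientation 𝓢 R) (h : IsCyclic 𝓢 R x y z) :
    ¬ ConnAvoiding 𝓢 y x z := fun hc => hR.asymm h.yz (hR.congr (hc.implies_left h.mem_y) h.xy)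

theorem not_connAvoiding_right (hR : IsOrientation 𝓢 R) (h : IsCyclic 𝓢 R x y z) :
    ¬ ConnAvoiding 𝓢 x y z := fun hc => hR.asymm h.zx (hR.congr (hc.implies_right h.mem_x) h.xy)

theorem connAvoiding_of_left (hR : IsOrientation 𝓢 R) (h : IsCyclic 𝓢 R x y z) {a : α}
    (ha : ConnAvoiding 𝓢 y x a) : ConnAvoiding 𝓢 z x a := by
  induction ha with
  | refl => exact .refl
  | tail hab hbc ih =>
    obtain ⟨S, hS, hb, hc, hy⟩ := hbc
    refine ih.tail ⟨S, hS, hb, hc, fun hz => ?_⟩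
    exact hR.not_connAvoiding_left h (hab.tail ⟨S, hS, hb, hz, hy⟩)

theorem connAvoiding_of_right (hR : IsOrientation 𝓢 R) (h : IsCyclic 𝓢 R x y z) {b : α}
    (hb : ConnAvoiding 𝓢 x y b) : ConnAvoiding 𝓢 z y b := by
  induction hb with
  | refl => exact .refl
  | tail hab hbc ih =>
    obtain ⟨S, hS, hb, hc, hx⟩ := hbc
    refine ih.tail ⟨S, hS, hb, hc, fun hz => ?_⟩
    exact hR.not_connAvoiding_right h (hab.tail ⟨S, hS, hb, hz, hx⟩)

/-- The implication class of a pair of a cyclic triple is contained in the product of the components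
of its two members. The reason is that a set of the family that left this product would connect the
third member of the triple to one of the two, or put the pair in one class with a pair that
involves the third member. -/
theorem implies_of_isCyclic (hR : IsOrientation 𝓢 R) (h : IsCyclic 𝓢 R x y z) {p : α × α}
    (hp : Implies 𝓢 (x, y) p) : ConnAvoiding 𝓢 y x p.1 ∧ ConnAvoiding 𝓢 x y p.2 := by
  induction hp with
  | refl => exact ⟨.refl, .refl⟩
  | tail hpq hqr ih =>
    obtain ⟨ih₁, ih₂⟩ := ih
    have hRq := hR.congr hpq h.xy
    cases hqr with
    | @left S a a' b hS ha ha' hb' hb =>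
      refine ⟨ih₁.tail ⟨S, hS, ha, ha', fun hy => ?_⟩, ih₂⟩
      by_cases hz : z ∈ S
      · have h₁ : R z b := hR.congr (.single (.left hS ha hz hb' hb)) hRq
        have h₂ := (hR.connAvoiding_of_right h ih₂).symm.implies_right h.mem_z
        exact hR.asymm h.yz (hR.congr h₂ h₁)
      · exact hR.not_connAvoiding_right h.rotate.rotate
          ((hR.connAvoiding_of_left h ih₁).tail ⟨S, hS, ha, hy, hz⟩)
    | @right S b b' a hS hb hb' ha' ha =>
      refine ⟨ih₁, ih₂.tail ⟨S, hS, hb, hb', fun hx => ?_⟩⟩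
      by_cases hz : z ∈ S
      · have h₁ : R a z := hR.congr (.single (.right hS hb hz ha' ha)) hRq
        have h₂ := (hR.connAvoiding_of_left h ih₁).symm.implies_left h.mem_z
        exact hR.asymm h.zx (hR.congr h₂ h₁)
      · exact hR.not_connAvoiding_left h.rotate
          ((hR.connAvoiding_of_right h ih₂).tail ⟨S, hS, hb, hx, hz⟩)

theorem not_connAvoiding_both (hR : IsOrientation 𝓢 R) (h : IsCyclic 𝓢 R x y z) {w : α}
    (hx : ConnAvoiding 𝓢 y x w) (hy : ConnAvoiding 𝓢 x y w) : False :=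
  hR.not_connAvoiding_right h.rotate.rotate
    ((hR.connAvoiding_of_left h hx).trans (hR.connAvoiding_of_right h hy).symm)

end IsOrientation

end Forcing

/-! ### Orienting each class by its first pair -/

/-- The ordered pairs of elements of the list `V`, in lexicographic order. -/
def pairs (V : List ℕ) : List (ℕ × ℕ) := V.flatMap fun a => V.map fun b => (a, b)

/-- `x` is put before `y` if they differ and, of the pairs that `same` relates to `(x, y)` or
`(y, x)`, the first one is related to `(x, y)`. -/
def before (V : List ℕ) (same : ℕ × ℕ → ℕ × ℕ → Bool) (x y : ℕ) : Bool :=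
  !decide (x = y) && match (pairs V).filter fun p => same p (x, y) || same p (y, x) with
  | [] => false
  | p :: _ => same p (x, y)

theorem mem_pairs {V : List ℕ} {p : ℕ × ℕ} : p ∈ pairs V ↔ p.1 ∈ V ∧ p.2 ∈ V := by
  rcases p with ⟨a, b⟩
  simp [pairs]

section Before

variable {𝓢 : Set (Set ℕ)} {V : List ℕ} {same : ℕ × ℕ → ℕ × ℕ → Bool}

theorem before_congr (hs : ∀ p q, same p q = true ↔ Implies 𝓢 p q) {a b c d : ℕ}
    (h : Implies 𝓢 (a, b) (c, d)) : before V same a b = before V same c d := by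
  have e : ∀ {q q' : ℕ × ℕ}, Implies 𝓢 q q' → ∀ p, same p q = same p q' := by
    intro q q' h p
    rw [Bool.eq_iff_iff, hs, hs]
    exact ⟨fun h' => h'.trans h, fun h' => h'.trans h.symm⟩
  have e₂ : Implies 𝓢 (b, a) (d, c) := h.swap
  have e₃ : a = b ↔ c = d := ⟨h.fst_eq_snd, h.symm.fst_eq_snd⟩
  simp only [before, e h, e e₂, e₃]

theorem ne_of_before {a b : ℕ} (h : before V same a b) : a ≠ b := by
  simp only [before, Bool.and_eq_true, Bool.not_eq_true', decide_eq_false_iff_not] at h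
  exact h.1

theorem before_asymm (hs : ∀ p q, same p q = true ↔ Implies 𝓢 p q) {a b : ℕ}
    (hab : a ≠ b → ¬ Implies 𝓢 (a, b) (b, a)) (h : before V same a b) : ¬ before V same b a := by
  specialize hab (ne_of_before h)
  unfold before at *
  simp only [Bool.or_comm (same _ (b, a)), Bool.and_eq_true, not_and] at h ⊢
  replace h := h.2
  intro _
  split at h
  · simp at h
  · intro h'
    exact hab (((hs _ _).1 h).symm.trans ((hs _ _).1 h'))

theorem before_total (hs : ∀ p q, same p q = true ↔ Implies 𝓢 p q) {a b : ℕ} (ha : a ∈ V)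
    (hb : b ∈ V) (hab : a ≠ b) : before V same a b ∨ before V same b a := by
  unfold before
  simp only [Bool.or_comm (same _ (b, a))]
  have hm : (a, b) ∈ (pairs V).filter fun p => same p (a, b) || same p (b, a) := by
    simp [mem_pairs, ha, hb, (hs _ _).2 .refl]
  rcases e : (pairs V).filter fun p => same p (a, b) || same p (b, a) with _ | ⟨p, l⟩
  · simp [e] at hm
  · have : p ∈ (pairs V).filter fun p => same p (a, b) || same p (b, a) := by simp [e]
    simpa [hab, hab.symm] using (List.mem_filter.1 this).2

/-- If the elements of `V` that come before `w` are not involved in the classes of `(x, y)` and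
`(y, x)` and `w` is, then these classes are oriented by a pair that starts with `w`. -/
theorem exists_implies_of_before (hs : ∀ p q, same p q = true ↔ Implies 𝓢 p q) {x y w : ℕ}
    {V₁ V₂ : List ℕ} (hV : V = V₁ ++ w :: V₂)
    (h₁ : ∀ v ∈ V₁, ∀ u, ¬ Implies 𝓢 (v, u) (x, y) ∧ ¬ Implies 𝓢 (v, u) (y, x))
    (hw : ∃ u ∈ V, Implies 𝓢 (w, u) (x, y) ∨ Implies 𝓢 (w, u) (y, x))
    (h : before V same x y) : ∃ u, Implies 𝓢 (w, u) (x, y) := by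
  have e : ∃ l m, (∀ p ∈ m, p.1 = w) ∧ m ≠ [] ∧
      (pairs V).filter (fun p => same p (x, y) || same p (y, x)) = m ++ l := by
    obtain ⟨u, hu, hw⟩ := hw
    refine ⟨(V₂.flatMap fun a => V.map fun b => (a, b)).filter
        (fun p => same p (x, y) || same p (y, x)),
      (V.map fun b => (w, b)).filter (fun p => same p (x, y) || same p (y, x)), ?_, ?_, ?_⟩
    · intro p hp
      obtain ⟨_, _, rfl⟩ := List.mem_map.1 (List.mem_filter.1 hp).1
      rfl
    · apply List.ne_nil_of_mem (a := (w, u))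
      simp [hu, hs, hw]
    · conv_lhs => rw [pairs]; enter [2, 2]; rw [hV]
      rw [List.flatMap_append, List.filter_append, List.flatMap_cons, List.filter_append]
      convert List.nil_append _
      rw [List.filter_eq_nil_iff]
      intro p hp
      simp only [List.mem_flatMap, List.mem_map] at hp
      obtain ⟨v, hv, u, _, rfl⟩ := hp
      simpa [hs] using h₁ v hv u
  obtain ⟨l, _ | ⟨p, m⟩, hm, hne, e⟩ := e
  · exact absurd rfl hne
  · unfold before at h
    rw [e] at h
    simp only [List.cons_append, Bool.and_eq_true] at h
    replace h := h.2
    obtain rfl := hm p (by simp)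
    exact ⟨p.2, (hs _ _).1 h⟩

/-- There is no cyclic triple. Otherwise the three components `A`, `B`, `C` of its members are
disjoint, and its three pairs have the classes contained in `A × B`, `B × C` and `C × A`. The first
element `w` of `V` in one of the components decides the orientation of two of these classes, and it
decides both in the same direction, away from its component. -/
theorem not_isCyclic_before (hs : ∀ p q, same p q = true ↔ Implies 𝓢 p q)
    (ho : IsOrientation 𝓢 fun a b => before V same a b) (hV₀ : ∀ v, v ∈ V ↔ v ∈ ⋃₀ 𝓢) {x y z : ℕ} :
    ¬ IsCyclic 𝓢 (fun a b => (before V same a b : Prop)) x y z := by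
  intro h
  let U : ℕ → Prop := fun w =>
    ConnAvoiding 𝓢 y x w ∨ ConnAvoiding 𝓢 z y w ∨ ConnAvoiding 𝓢 x z w
  classical
  obtain ⟨w, hw⟩ : ∃ w, V.find? (fun w => U w) = some w := by
    rw [← Option.isSome_iff_exists, List.find?_isSome]
    exact ⟨x, (hV₀ x).2 h.mem_x, by simp [U, Relation.ReflTransGen.refl]⟩
  obtain ⟨hUw, V₁, V₂, hV, hV₁⟩ := List.find?_eq_some_iff_append.1 hw
  replace hV₁ : ∀ v ∈ V₁, ¬ U v := by simpa using hV₁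
  -- the argument for `w` in the component of the second member of a cyclic triple
  have key : ∀ {x y z : ℕ}, IsCyclic 𝓢 (fun a b => (before V same a b : Prop)) x y z →
      (∀ v ∈ V₁, ¬ (ConnAvoiding 𝓢 y x v ∨ ConnAvoiding 𝓢 z y v)) → ConnAvoiding 𝓢 z y w →
      False := by
    intro x y z h hV₁ hw
    have hc : ∀ {v}, ConnAvoiding 𝓢 x y v → ConnAvoiding 𝓢 z y v := ho.connAvoiding_of_right h
    have hw' : ConnAvoiding 𝓢 x y w := ho.connAvoiding_of_left h.rotate hw
    obtain ⟨u, hu⟩ := exists_implies_of_before hs hV (fun v hv u => by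
      refine ⟨fun hi => hV₁ v hv (.inl (ho.implies_of_isCyclic h hi.symm).1), fun hi => ?_⟩
      exact hV₁ v hv (.inr (hc (ho.implies_of_isCyclic h hi.symm.swap).2)))
      ⟨x, (hV₀ x).2 h.mem_x, .inr (hw'.symm.implies_left h.mem_x)⟩ h.xy
    exact ho.not_connAvoiding_both h (ho.implies_of_isCyclic h hu.symm).1 hw'
  have hUw : U w := by simpa using hUw
  rcases hUw with hw | hw | hw
  · exact key h.rotate.rotate (fun v hv => by have := hV₁ v hv; simp only [U] at this; tauto) hw
  · exact key h (fun v hv => by have := hV₁ v hv; simp only [U] at this; tauto) hw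
  · exact key h.rotate (fun v hv => by have := hV₁ v hv; simp only [U] at this; tauto) hw

end Before

/-! ### Computing the classes -/

/-- Join the classes of `Cs` that contain one of the two ends of the edge `e`. -/
def merge (Cs : List (List (ℕ × ℕ))) (e : (ℕ × ℕ) × (ℕ × ℕ)) : List (List (ℕ × ℕ)) :=
  (e.1 :: e.2 :: (Cs.filter fun C => decide (e.1 ∈ C) || decide (e.2 ∈ C)).flatten) ::
    Cs.filter fun C => !(decide (e.1 ∈ C) || decide (e.2 ∈ C))

/-- `p` and `q` are equal or in a common class. -/
def sameClass (Cs : List (List (ℕ × ℕ))) (p q : ℕ × ℕ) : Bool :=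
  decide (p = q) || Cs.any fun C => decide (p ∈ C) && decide (q ∈ C)

theorem sameClass_iff {Cs : List (List (ℕ × ℕ))} {p q : ℕ × ℕ} :
    sameClass Cs p q ↔ p = q ∨ ∃ C ∈ Cs, p ∈ C ∧ q ∈ C := by
  simp [sameClass]

instance : Std.Symm (List.Disjoint (α := ℕ × ℕ)) := ⟨fun _ _ h => h.symm⟩

/-- Distinct classes are disjoint, which makes `sameClass` transitive. -/
theorem pairwise_disjoint_merge {Cs : List (List (ℕ × ℕ))} (h : Cs.Pairwise List.Disjoint)
    (e : (ℕ × ℕ) × (ℕ × ℕ)) : (merge Cs e).Pairwise List.Disjoint := by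
  refine List.pairwise_cons.2 ⟨fun D hD => ?_, h.filter _⟩
  obtain ⟨hD, heD⟩ := List.mem_filter.1 hD
  simp at heD
  intro p hp hpD
  simp only [List.mem_cons, List.mem_flatten, List.mem_filter] at hp
  rcases hp with rfl | rfl | ⟨C, ⟨hC, he⟩, hpC⟩
  · exact heD.1 hpD
  · exact heD.2 hpD
  · have hne : C ≠ D := by
      rintro rfl
      simp [heD] at he
    exact h.forall hC hD hne hpC hpD

theorem sameClass_trans {Cs : List (List (ℕ × ℕ))} (h : Cs.Pairwise List.Disjoint)
    {p q r : ℕ × ℕ} (hpq : sameClass Cs p q) (hqr : sameClass Cs q r) : sameClass Cs p r := by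
  rw [sameClass_iff] at *
  rcases hpq with rfl | ⟨C, hC, hp, hq⟩
  · exact hqr
  rcases hqr with rfl | ⟨D, hD, hq', hr⟩
  · exact .inr ⟨C, hC, hp, hq⟩
  by_cases e : C = D
  · subst e
    exact .inr ⟨C, hC, hp, hr⟩
  · exact absurd hq' (h.forall hC hD e hq)

theorem sameClass_merge_of_sameClass {Cs : List (List (ℕ × ℕ))} {p q : ℕ × ℕ}
    (h : sameClass Cs p q) (e : (ℕ × ℕ) × (ℕ × ℕ)) : sameClass (merge Cs e) p q := by
  rw [sameClass_iff] at *
  refine h.imp_right ?_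
  rintro ⟨C, hC, hp, hq⟩
  by_cases he : decide (e.1 ∈ C) || decide (e.2 ∈ C)
  · refine ⟨_, List.mem_cons_self, ?_, ?_⟩ <;>
    · simp only [List.mem_cons, List.mem_flatten, List.mem_filter]
      exact .inr (.inr ⟨C, ⟨hC, he⟩, by assumption⟩)
  · exact ⟨C, List.mem_cons_of_mem _ (List.mem_filter.2 ⟨hC, by simpa using he⟩), hp, hq⟩

theorem sameClass_merge_self (Cs : List (List (ℕ × ℕ))) (e : (ℕ × ℕ) × (ℕ × ℕ)) :
    sameClass (merge Cs e) e.1 e.2 :=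
  sameClass_iff.2 (.inr ⟨_, List.mem_cons_self, by simp, by simp⟩)

theorem merge_sound {𝓢 : Set (Set ℕ)} {Cs : List (List (ℕ × ℕ))}
    (h : ∀ C ∈ Cs, ∀ p ∈ C, ∀ q ∈ C, Implies 𝓢 p q) {e : (ℕ × ℕ) × (ℕ × ℕ)}
    (he : Implies 𝓢 e.1 e.2) : ∀ C ∈ merge Cs e, ∀ p ∈ C, ∀ q ∈ C, Implies 𝓢 p q := by
  intro C hC
  rcases List.mem_cons.1 hC with rfl | hC
  · have key : ∀ p ∈ e.1 :: e.2 ::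
        (Cs.filter fun C => decide (e.1 ∈ C) || decide (e.2 ∈ C)).flatten, Implies 𝓢 e.1 p := by
      intro p hp
      simp only [List.mem_cons, List.mem_flatten, List.mem_filter] at hp
      rcases hp with rfl | rfl | ⟨C, ⟨hC, h'⟩, hpC⟩
      · exact .refl
      · exact he
      · simp only [Bool.or_eq_true, decide_eq_true_eq] at h'
        rcases h' with h' | h'
        · exact h C hC _ h' _ hpC
        · exact he.trans (h C hC _ h' _ hpC)
    exact fun p hp q hq => (key p hp).symm.trans (key q hq)
  · exact h C (List.mem_filter.1 hC).1

/-- If `E` lists the edges of the implication graph, the classes obtained by joining along all of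
them are its connected components. -/
theorem sameClass_foldl_merge {𝓢 : Set (Set ℕ)} {E : List ((ℕ × ℕ) × (ℕ × ℕ))}
    (hE : ∀ e, e ∈ E ↔ Forces 𝓢 e.1 e.2) (p q : ℕ × ℕ) :
    sameClass (E.foldl merge []) p q ↔ Implies 𝓢 p q := by
  have hpair : ∀ (E : List ((ℕ × ℕ) × (ℕ × ℕ))) (Cs : List (List (ℕ × ℕ))),
      Cs.Pairwise List.Disjoint → (E.foldl merge Cs).Pairwise List.Disjoint := by
    intro E
    induction E with
    | nil => exact fun _ h => h
    | cons e E ih => exact fun Cs h => ih _ (pairwise_disjoint_merge h e)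
  have hmono : ∀ (E : List ((ℕ × ℕ) × (ℕ × ℕ))) (Cs : List (List (ℕ × ℕ))) {p q : ℕ × ℕ},
      sameClass Cs p q → sameClass (E.foldl merge Cs) p q := by
    intro E
    induction E with
    | nil => exact fun _ _ _ h => h
    | cons e E ih => exact fun Cs _ _ h => ih _ (sameClass_merge_of_sameClass h e)
  have hedge : ∀ (E : List ((ℕ × ℕ) × (ℕ × ℕ))) (Cs : List (List (ℕ × ℕ))), ∀ e ∈ E,
      sameClass (E.foldl merge Cs) e.1 e.2 := by
    intro E
    induction E with
    | nil => simp
    | cons e E ih =>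
      intro Cs e' he'
      rcases List.mem_cons.1 he' with rfl | he'
      · exact hmono E _ (sameClass_merge_self _ _)
      · exact ih _ e' he'
  have hsound : ∀ (E : List ((ℕ × ℕ) × (ℕ × ℕ))) (Cs : List (List (ℕ × ℕ))),
      (∀ e ∈ E, Implies 𝓢 e.1 e.2) → (∀ C ∈ Cs, ∀ p ∈ C, ∀ q ∈ C, Implies 𝓢 p q) →
      ∀ C ∈ E.foldl merge Cs, ∀ p ∈ C, ∀ q ∈ C, Implies 𝓢 p q := by
    intro E
    induction E with
    | nil => exact fun _ _ h => h
    | cons e E ih =>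
      exact fun Cs he h => ih _ (fun e' h' => he e' (by simp [h'])) (merge_sound h (he e (by simp)))
  constructor
  · intro h
    rcases sameClass_iff.1 h with rfl | ⟨C, hC, hp, hq⟩
    · exact .refl
    · exact hsound E [] (fun e he => .single ((hE e).1 he)) (by simp) C hC p hp q hq
  · intro h
    induction h with
    | refl => simp [sameClass_iff]
    | tail _ h ih =>
      exact sameClass_trans (hpair E [] .nil) ih (hedge E [] (_, _) ((hE (_, _)).2 h))

/-- The edges of the implication graph of the family of lists `L`, whose ground set is the union of
these lists. -/
def edges (L : List (List ℕ)) : List ((ℕ × ℕ) × (ℕ × ℕ)) :=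
  L.flatMap fun S => S.flatMap fun a => S.flatMap fun b =>
    (L.flatten.filter fun c => !decide (c ∈ S)).flatMap fun c =>
      [((a, c), (b, c)), ((c, a), (c, b))]

/-! ### Sorting -/

/-- Insert `x` into a list sorted by `r`, unless it occurs there. -/
def insertBy (r : ℕ → ℕ → Bool) (s : List ℕ) (x : ℕ) : List ℕ :=
  if decide (x ∈ s) then s else (s.filter fun y => r y x) ++ x :: s.filter fun y => !r y x

theorem mem_insertBy {r : ℕ → ℕ → Bool} {s : List ℕ} {x y : ℕ} :
    y ∈ insertBy r s x ↔ y = x ∨ y ∈ s := by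
  unfold insertBy
  split
  · rename_i h
    simp only [decide_eq_true_eq] at h
    constructor
    · exact .inr
    · rintro (rfl | h') <;> assumption
  · simp only [List.mem_append, List.mem_filter, List.mem_cons, Bool.not_eq_true']
    cases r y x <;> simp [or_comm]

theorem pairwise_insertBy {r : ℕ → ℕ → Bool} {s : List ℕ} {x : ℕ} (h : s.Pairwise fun a b => r a b)
    (htot : ∀ a ∈ s, a ≠ x → r a x ∨ r x a)
    (htr : ∀ a ∈ s, ∀ b ∈ s, r a x → r x b → r a b) :
    (insertBy r s x).Pairwise fun a b => r a b := by
  unfold insertBy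
  split
  · exact h
  · rename_i hx
    have hxb : ∀ b ∈ s.filter fun y => !r y x, r x b := by
      intro b hb
      obtain ⟨hbs, hbx⟩ := List.mem_filter.1 hb
      refine (htot b hbs ?_).resolve_left (by simpa using hbx)
      rintro rfl
      exact hx (decide_eq_true hbs)
    refine List.pairwise_append.2 ⟨h.filter _, List.pairwise_cons.2 ⟨hxb, h.filter _⟩, ?_⟩
    intro a ha b hb
    obtain ⟨ha, hax⟩ := List.mem_filter.1 ha
    rcases List.mem_cons.1 hb with rfl | hb
    · exact hax
    · exact htr a ha b (List.mem_filter.1 hb).1 hax (hxb b hb)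

theorem foldl_insertBy {r : ℕ → ℕ → Bool} {V : List ℕ}
    (htot : ∀ a ∈ V, ∀ b ∈ V, a ≠ b → r a b ∨ r b a)
    (htr : ∀ a ∈ V, ∀ b ∈ V, ∀ c ∈ V, r a b → r b c → r a c) :
    (V.foldl (insertBy r) []).Pairwise (fun a b => r a b) ∧
      ∀ y, y ∈ V.foldl (insertBy r) [] ↔ y ∈ V := by
  have key : ∀ l s : List ℕ, (∀ y ∈ l, y ∈ V) → (∀ y ∈ s, y ∈ V) → s.Pairwise (fun a b => r a b) →
      (l.foldl (insertBy r) s).Pairwise (fun a b => r a b) ∧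
        ∀ y, y ∈ l.foldl (insertBy r) s ↔ y ∈ s ∨ y ∈ l := by
    intro l
    induction l with
    | nil => exact fun s _ _ h => ⟨h, by simp⟩
    | cons x l ih =>
      intro s hl hs h
      have hx := hl x (by simp)
      obtain ⟨h₁, h₂⟩ := ih (insertBy r s x) (fun y hy => hl y (by simp [hy]))
        (fun y hy => by
          rcases mem_insertBy.1 hy with rfl | hy
          exacts [hx, hs y hy])
        (pairwise_insertBy h (fun a ha => htot a (hs a ha) x hx)
          fun a ha b hb => htr a (hs a ha) x hx b (hs b hb))
      refine ⟨h₁, fun y => ?_⟩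
      rw [List.foldl_cons, h₂, mem_insertBy, List.mem_cons]
      tauto
  simpa using key V [] (fun _ h => h) (by simp) .nil

/-- The ordering computed from the lists `L` of variables of the clauses. -/
def convexOrdering (L : List (List ℕ)) : List ℕ :=
  L.flatten.foldl (insertBy (before L.flatten (sameClass ((edges L).foldl merge [])))) []

/-! ### Counting subterms along a convex ordering -/

namespace CNF

variable {F : CNF} {σ : List ℕ} {j : ℕ}

/-- The variables of `c` that lie in `X`. -/
def trace (c : Clause) (X : Finset ℕ) : Finset ℕ := c.vars ∩ X

/-- The clauses of `F` with variables inside and outside of `X`. -/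
def crossing (F : CNF) (X : Finset ℕ) : Finset Clause :=
  F.clauses.filter fun c => (trace c X).Nonempty ∧ ¬ c.vars ⊆ X

theorem mem_vars {v : ℕ} {c : Clause} (hc : c ∈ F.clauses) (hv : v ∈ c.vars) : v ∈ F.vars :=
  Finset.mem_biUnion.2 ⟨c, hc, hv⟩

theorem mem_crossing {X : Finset ℕ} {c : Clause} :
    c ∈ F.crossing X ↔ c ∈ F.clauses ∧ (trace c X).Nonempty ∧ ¬ c.vars ⊆ X := Finset.mem_filter

theorem card_crossing_le (F : CNF) (X : Finset ℕ) : (F.crossing X).card ≤ F.size := by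
  rw [Finset.card_eq_sum_ones, size]
  refine (Finset.sum_le_sum fun c hc => ?_).trans
    (Finset.sum_le_sum_of_subset (Finset.filter_subset _ _))
  obtain ⟨v, hv⟩ := (mem_crossing.1 hc).2.1
  obtain ⟨l, hl, -⟩ := Finset.mem_image.1 (Finset.mem_inter.1 hv).1
  exact Finset.card_pos.2 ⟨l, hl⟩

theorem convex (h : WitnessesLeftConvexity σ F.inc) {c : Clause} (hc : c ∈ F.clauses)
    {v v'' v' : ℕ} (hv : v ∈ c.vars) (hv' : v' ∈ c.vars) (hv'' : v'' ∈ F.vars)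
    (h₁ : Precedes σ v v'') (h₂ : Precedes σ v'' v') : v'' ∈ c.vars :=
  (h.2 c hc v (mem_vars hc hv) v'' hv'' v' (mem_vars hc hv') ⟨mem_vars hc hv, hc, hv⟩
    ⟨mem_vars hc hv', hc, hv'⟩ h₁ h₂).2.2

theorem precedes_of_mem_take {u w : ℕ} (hu : u ∈ (σ.take j).toFinset)
    (hw : w ∉ (σ.take j).toFinset) (hw' : w ∈ σ) : Precedes σ u w := by
  rw [List.mem_toFinset] at hu hw
  rw [List.mem_take_iff_idxOf_lt hw', not_lt] at hw
  exact ((List.mem_take_iff_idxOf_lt (List.mem_of_mem_take hu)).1 hu).trans_le hw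

/-- The traces of crossing clauses on a prefix are suffixes of this prefix, hence nested. -/
theorem trace_subset_of_card_le (h : WitnessesLeftConvexity σ F.inc) {c d : Clause}
    (hc : c ∈ F.crossing (σ.take j).toFinset) (hd : d ∈ F.crossing (σ.take j).toFinset)
    (hcard : (trace d (σ.take j).toFinset).card ≤ (trace c (σ.take j).toFinset).card) :
    trace d (σ.take j).toFinset ⊆ trace c (σ.take j).toFinset := by
  set X := (σ.take j).toFinset with hX
  obtain ⟨hcF, -, hcX⟩ := mem_crossing.1 hc
  obtain ⟨hdF, -, hdX⟩ := mem_crossing.1 hd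
  obtain ⟨w, hwc, hwX⟩ := Finset.not_subset.1 hcX
  obtain ⟨w', hwd, hwX'⟩ := Finset.not_subset.1 hdX
  have hσ : ∀ {v}, v ∈ F.vars → v ∈ σ := fun hv => by
    rw [← List.mem_toFinset, h.1.2]
    exact hv
  by_contra hsub
  obtain ⟨v, hvd, hvc⟩ := Finset.not_subset.1 hsub
  obtain ⟨hvd, hvX⟩ := Finset.mem_inter.1 hvd
  have hvc' : v ∉ c.vars := fun hv => hvc (Finset.mem_inter.2 ⟨hv, hvX⟩)
  refine absurd hcard (not_le.2 (Finset.card_lt_card (Finset.ssubset_iff_subset_ne.2 ⟨?_, ?_⟩)))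
  · intro u hu
    obtain ⟨huc, huX⟩ := Finset.mem_inter.1 hu
    refine Finset.mem_inter.2 ⟨?_, huX⟩
    rcases lt_trichotomy (σ.idxOf u) (σ.idxOf v) with huv | huv | huv
    · exact absurd (convex h hcF huc hwc (mem_vars hdF hvd) huv
        (precedes_of_mem_take hvX hwX (hσ (mem_vars hcF hwc)))) hvc'
    · rw [List.idxOf_inj (hσ (mem_vars hcF huc))] at huv
      exact absurd (huv ▸ huc) hvc'
    · exact convex h hdF hvd hwd (mem_vars hcF huc) huv
        (precedes_of_mem_take huX hwX' (hσ (mem_vars hdF hwd)))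
  · intro e
    rw [e] at hvc
    exact hvc (Finset.mem_inter.2 ⟨hvd, hvX⟩)

/-- Two assignments that do not satisfy `c` agree on the variables of `c`, so they satisfy the same
clauses among those whose trace is contained in that of `c`. -/
theorem satBy_congr {X : Finset ℕ} {c d : Clause} {f g : X → Bool} (hsub : trace d X ⊆ trace c X)
    (hf : ¬ c.SatBy f) (hg : ¬ c.SatBy g) (hd : d.SatBy f) : d.SatBy g := by
  obtain ⟨l, hl, hX, e⟩ := hd
  refine ⟨l, hl, hX, ?_⟩
  have hc : l.1 ∈ c.vars :=
    (Finset.mem_inter.1 (hsub (Finset.mem_inter.2 ⟨Finset.mem_image_of_mem _ hl, hX⟩))).1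
  obtain ⟨l', hl', e'⟩ := Finset.mem_image.1 hc
  have hX' : l'.1 ∈ X := e' ▸ hX
  have h₁ : f ⟨l'.1, hX'⟩ ≠ l'.2 := fun h => hf ⟨l', hl', hX', h⟩
  have h₂ : g ⟨l'.1, hX'⟩ ≠ l'.2 := fun h => hg ⟨l', hl', hX', h⟩
  have e₃ : (⟨l'.1, hX'⟩ : X) = ⟨l.1, hX⟩ := Subtype.ext e'
  rw [e₃] at h₁ h₂
  rw [← e, Bool.eq_not_of_ne h₁, Bool.eq_not_of_ne h₂]

theorem satBy_of_trace_eq_empty {X : Finset ℕ} {c : Clause} {f : X → Bool}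
    (h : ¬ (trace c X).Nonempty) : ¬ c.SatBy f := by
  rintro ⟨l, hl, hX, -⟩
  exact h ⟨l.1, Finset.mem_inter.2 ⟨Finset.mem_image_of_mem _ hl, hX⟩⟩

theorem delete_of_subset {X : Finset ℕ} {c : Clause} (h : c.vars ⊆ X) : c.delete X = ∅ :=
  Finset.filter_eq_empty_iff.2 fun _ hl => not_not.2 (h (Finset.mem_image_of_mem _ hl))

/-- A subterm consists of the clauses without variables in `X`, what is left of the unsatisfied
crossing clauses, and the empty clause if some clause within `X` is unsatisfied. -/
theorem restrict_subset {X : Finset ℕ} {f g : X → Bool}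
    (h₁ : ∀ c ∈ F.crossing X, ¬ c.SatBy f → ¬ c.SatBy g)
    (h₂ : (∃ c ∈ F.clauses, c.vars ⊆ X ∧ ¬ c.SatBy f) → ∃ c ∈ F.clauses, c.vars ⊆ X ∧ ¬ c.SatBy g) :
    (F.restrict f).clauses ⊆ (F.restrict g).clauses := by
  classical
  intro d hd
  obtain ⟨c, hc, rfl⟩ := Finset.mem_image.1 hd
  obtain ⟨hcF, hcf⟩ := Finset.mem_filter.1 hc
  by_cases hcX : c.vars ⊆ X
  · obtain ⟨c', hc', hX', hg⟩ := h₂ ⟨c, hcF, hcX, hcf⟩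
    exact Finset.mem_image.2 ⟨c', Finset.mem_filter.2 ⟨hc', hg⟩, by
      rw [delete_of_subset hcX, delete_of_subset hX']⟩
  · refine Finset.mem_image_of_mem _ (Finset.mem_filter.2 ⟨hcF, ?_⟩)
    by_cases hne : (trace c X).Nonempty
    · exact h₁ c (mem_crossing.2 ⟨hcF, hne, hcX⟩) hcf
    · exact satBy_of_trace_eq_empty hne

/-- There are at most as many subterms as pairs of a crossing clause, or none, and a truth value. -/
theorem ncard_subterms_le (h : WitnessesLeftConvexity σ F.inc) (j : ℕ) :
    (F.subterms (σ.take j).toFinset).ncard ≤ 2 * (F.size + 1) := by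
  classical
  set X := (σ.take j).toFinset with hX
  -- a crossing clause of maximal trace among those that `f` does not satisfy, if there are any
  have hkey : ∀ f : X → Bool, ∃ o : Option Clause, (∀ c ∈ o, c ∈ F.crossing X ∧ ¬ c.SatBy f) ∧
      ∀ d ∈ F.crossing X, ¬ d.SatBy f → ∃ c ∈ o, (trace d X).card ≤ (trace c X).card := by
    intro f
    rcases ((F.crossing X).filter fun c => ¬ c.SatBy f).eq_empty_or_nonempty with he | hne
    · refine ⟨none, by simp, fun d hd hdf => ?_⟩
      exact absurd (Finset.mem_filter.2 ⟨hd, hdf⟩) (he ▸ Finset.notMem_empty d)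
    · obtain ⟨c, hc, hmax⟩ := Finset.exists_max_image _ (fun c => (trace c X).card) hne
      refine ⟨some c, by simpa using hc, fun d hd hdf => ⟨c, rfl, ?_⟩⟩
      exact hmax d (Finset.mem_filter.2 ⟨hd, hdf⟩)
  choose key hk₁ hk₂ using hkey
  let profile : (X → Bool) → Option Clause × Bool := fun f =>
    (key f, decide (∃ c ∈ F.clauses, c.vars ⊆ X ∧ ¬ c.SatBy f))
  have hsub : ∀ f g, profile f = profile g → (F.restrict f).clauses ⊆ (F.restrict g).clauses := by
    intro f g e
    obtain ⟨e₁, e₂⟩ := Prod.ext_iff.1 e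
    refine restrict_subset (fun d hd hdf hdg => ?_) (decide_eq_decide.1 e₂).1
    obtain ⟨c, hc, hcard⟩ := hk₂ f d hd hdf
    obtain ⟨hc', hcf⟩ := hk₁ f c hc
    have hcg := (hk₁ g c (by rwa [← show key f = key g from e₁])).2
    exact hdf (satBy_congr (trace_subset_of_card_le h hc' hd hcard) hcg hcf hdg)
  have hfac : ∀ f g, profile f = profile g → F.restrict f = F.restrict g := fun f g e =>
    CNF.ext ((hsub f g e).antisymm (hsub g f e.symm))
  let K := (F.crossing X).insertNone ×ˢ (Finset.univ : Finset Bool)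
  have hst : F.subterms X ⊆
      (fun k => if hk : ∃ f, profile f = k then F.restrict hk.choose else F) ''
      (K : Set (Option Clause × Bool)) := by
    rintro G ⟨f, rfl⟩
    refine ⟨profile f, ?_, ?_⟩
    · simp only [K, Finset.coe_product, Set.mem_prod, Finset.mem_coe, Finset.mem_univ, and_true,
        Finset.mem_insertNone]
      exact fun c hc => (hk₁ f c hc).1
    · have hk : ∃ g, profile g = profile f := ⟨f, rfl⟩
      simp only [dif_pos hk]
      exact hfac _ _ hk.choose_spec
  calc (F.subterms X).ncard ≤ _ := Set.ncard_le_ncard hst (K.finite_toSet.image _)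
    _ ≤ (K : Set (Option Clause × Bool)).ncard := Set.ncard_image_le K.finite_toSet
    _ = ((F.crossing X).card + 1) * 2 := by
      rw [Set.ncard_coe_finset, Finset.card_product, Finset.card_insertNone]; rfl
    _ ≤ 2 * (F.size + 1) := by have := F.card_crossing_le X; omega

theorem stw_le (h : WitnessesLeftConvexity σ F.inc) : F.stw σ ≤ 2 * (F.size + 1) :=
  Finset.sup_le fun j _ => ncard_subterms_le h j

theorem subtermWidth_le (h : IsOrdering σ F.vars) : F.subtermWidth ≤ F.stw σ :=
  Nat.sInf_le ⟨σ, h, rfl⟩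

end CNF

/-! ### Correctness of the computed ordering -/

/-- The sets of elements of the lists in `L`. -/
def setFamily (L : List (List ℕ)) : Set (Set ℕ) := {S | ∃ l ∈ L, S = {v | v ∈ l}}

theorem mem_sUnion_setFamily {L : List (List ℕ)} {v : ℕ} : v ∈ L.flatten ↔ v ∈ ⋃₀ setFamily L := by
  rw [List.mem_flatten]
  constructor
  · rintro ⟨l, hl, hv⟩
    exact ⟨_, ⟨l, hl, rfl⟩, hv⟩
  · rintro ⟨_, ⟨l, hl, rfl⟩, hv⟩
    exact ⟨l, hl, hv⟩

theorem mem_edges {L : List (List ℕ)} (e : (ℕ × ℕ) × (ℕ × ℕ)) :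
    e ∈ edges L ↔ Forces (setFamily L) e.1 e.2 := by
  have h : e ∈ edges L ↔ ∃ S ∈ L, ∃ a ∈ S, ∃ b ∈ S, ∃ c ∈ L.flatten, c ∉ S ∧
      (e = ((a, c), (b, c)) ∨ e = ((c, a), (c, b))) := by
    simp only [edges, List.mem_flatMap, List.mem_filter, Bool.not_eq_true',
      decide_eq_false_iff_not, List.mem_cons, List.not_mem_nil, or_false, and_assoc]
  rw [h]
  constructor
  · rintro ⟨S, hS, a, ha, b, hb, c, hc, hcS, rfl | rfl⟩
    · exact .left (S := {v | v ∈ S}) ⟨S, hS, rfl⟩ ha hb (mem_sUnion_setFamily.1 hc) hcS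
    · exact .right (S := {v | v ∈ S}) ⟨S, hS, rfl⟩ ha hb (mem_sUnion_setFamily.1 hc) hcS
  · intro h
    rcases e with ⟨p, q⟩
    simp only at h
    cases h with
    | @left _ a b c hS ha hb hc hcS =>
      obtain ⟨S, hS, rfl⟩ := hS
      exact ⟨S, hS, a, ha, b, hb, c, mem_sUnion_setFamily.2 hc, hcS, .inl rfl⟩
    | @right _ a b c hS ha hb hc hcS =>
      obtain ⟨S, hS, rfl⟩ := hS
      exact ⟨S, hS, a, ha, b, hb, c, mem_sUnion_setFamily.2 hc, hcS, .inr rfl⟩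

/-- The relation `r` is asymmetric, total on the union of `L`, and makes the lists in `L` intervals.
Transitivity is left out, since only the orientation of pairs matters. -/
structure IsConvexOrder (L : List (List ℕ)) (r : ℕ → ℕ → Prop) : Prop where
  asymm : ∀ {a b}, r a b → ¬ r b a
  total : ∀ {a b}, a ∈ L.flatten → b ∈ L.flatten → a ≠ b → r a b ∨ r b a
  convex : ∀ {S a b c}, S ∈ L → a ∈ S → b ∈ S → c ∈ L.flatten → r a c → r c b → c ∈ S

namespace IsConvexOrder

variable {L : List (List ℕ)} {r : ℕ → ℕ → Prop}

theorem iff_of_forces (h : IsConvexOrder L r) {p q : ℕ × ℕ} (hpq : Forces (setFamily L) p q) :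
    r p.1 p.2 ↔ r q.1 q.2 := by
  have key : ∀ {p q : ℕ × ℕ}, Forces (setFamily L) p q → r p.1 p.2 → r q.1 q.2 := by
    intro p q hpq hp
    have hq := hpq.symm.mem_and_ne
    refine (h.total (mem_sUnion_setFamily.2 hq.1) (mem_sUnion_setFamily.2 hq.2.1)
      hq.2.2).resolve_right fun hq' => ?_
    cases hpq with
    | left hS ha hb hc hcS =>
      obtain ⟨S, hS, rfl⟩ := hS
      exact hcS (h.convex hS ha hb (mem_sUnion_setFamily.2 hc) hp hq')
    | right hS ha hb hc hcS =>
      obtain ⟨S, hS, rfl⟩ := hS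
      exact hcS (h.convex hS hb ha (mem_sUnion_setFamily.2 hc) hq' hp)
  exact ⟨key hpq, key hpq.symm⟩

theorem iff_of_implies (h : IsConvexOrder L r) {p q : ℕ × ℕ} (hpq : Implies (setFamily L) p q) :
    r p.1 p.2 ↔ r q.1 q.2 := by
  induction hpq with
  | refl => exact Iff.rfl
  | tail _ h' ih => exact ih.trans (h.iff_of_forces h')

theorem not_implies_swap (h : IsConvexOrder L r) {a b : ℕ} (hab : a ≠ b) :
    ¬ Implies (setFamily L) (a, b) (b, a) := by
  intro hi
  have e := h.iff_of_implies hi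
  rcases hi.eq_or_mem_and_ne with h' | ⟨ha, hb, -⟩
  · exact hab (Prod.ext_iff.1 h').1
  · rcases h.total (mem_sUnion_setFamily.2 ha) (mem_sUnion_setFamily.2 hb) hab with h' | h'
    · exact h.asymm h' (e.1 h')
    · exact h.asymm h' (e.2 h')

end IsConvexOrder

/-- If some order makes all lists in `L` intervals, then so does the computed ordering. -/
theorem convexOrdering_spec {L : List (List ℕ)} {r : ℕ → ℕ → Prop} (h : IsConvexOrder L r) :
    (convexOrdering L).Nodup ∧ (∀ v, v ∈ convexOrdering L ↔ v ∈ L.flatten) ∧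
      ∀ S ∈ L, ∀ v ∈ S, ∀ v' ∈ S, ∀ v'' ∈ L.flatten, Precedes (convexOrdering L) v v'' →
        Precedes (convexOrdering L) v'' v' → v'' ∈ S := by
  let same := sameClass ((edges L).foldl merge [])
  have hs : ∀ p q, same p q = true ↔ Implies (setFamily L) p q := sameClass_foldl_merge mem_edges
  let B : ℕ → ℕ → Bool := before L.flatten same
  have hasymm : ∀ {a b}, B a b → ¬ B b a := before_asymm hs h.not_implies_swap
  have ho : IsOrientation (setFamily L) fun a b => B a b :=
    ⟨fun hi hab => by rwa [← show B _ _ = B _ _ from before_congr hs hi], hasymm⟩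
  obtain ⟨hp, hm⟩ := foldl_insertBy (r := B) (V := L.flatten)
    (fun a ha b hb => before_total hs ha hb) (fun a ha b hb c hc hab hbc => by
      have hac : a ≠ c := by
        rintro rfl
        exact hasymm hab hbc
      refine (before_total hs ha hc hac).resolve_right fun hca => ?_
      exact not_isCyclic_before hs ho (fun _ => mem_sUnion_setFamily)
        ⟨mem_sUnion_setFamily.1 ha, mem_sUnion_setFamily.1 hb, mem_sUnion_setFamily.1 hc,
          hab, hbc, hca⟩)
  change (convexOrdering L).Pairwise _ at hp
  change ∀ y, y ∈ convexOrdering L ↔ _ at hm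
  have hB : ∀ {a b}, a ∈ L.flatten → b ∈ L.flatten → Precedes (convexOrdering L) a b → B a b := by
    intro a b ha hb hab
    have := List.pairwise_iff_getElem.1 hp _ _ (List.idxOf_lt_length_of_mem ((hm a).2 ha))
      (List.idxOf_lt_length_of_mem ((hm b).2 hb)) hab
    simpa using this
  refine ⟨hp.imp fun hab => ne_of_before hab, hm, fun S hS v hv v' hv' v'' hv'' h₁ h₂ => ?_⟩
  by_contra hn
  have hv₁ := hB (List.mem_flatten.2 ⟨S, hS, hv⟩) hv'' h₁
  have hv₂ := hB hv'' (List.mem_flatten.2 ⟨S, hS, hv'⟩) h₂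
  refine hasymm hv₂ (ho.congr (.single (.left (S := {v | v ∈ S}) ⟨S, hS, rfl⟩ hv hv'
    (mem_sUnion_setFamily.1 hv'') hn)) hv₁)

/-- The lists of variables of the clauses listed by `L`. -/
def varLists (L : List (List Literal)) : List (List ℕ) := L.map fun c => c.map Prod.fst

theorem mem_varLists {L : List (List Literal)} {F : CNF} (hL : Represents L F) :
    (∀ S ∈ varLists L, ∃ c ∈ F.clauses, ∀ v, v ∈ S ↔ v ∈ c.vars) ∧
      ∀ c ∈ F.clauses, ∃ S ∈ varLists L, ∀ v, v ∈ S ↔ v ∈ c.vars := by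
  have hl : ∀ (l : List Literal) v, v ∈ l.map Prod.fst ↔ v ∈ Clause.vars l.toFinset := by
    simp [Clause.vars]
  constructor
  · intro S hS
    obtain ⟨l, hl', rfl⟩ := List.mem_map.1 hS
    refine ⟨l.toFinset, ?_, hl l⟩
    rw [← hL, List.mem_toFinset]
    exact List.mem_map_of_mem hl'
  · intro c hc
    rw [← hL, List.mem_toFinset] at hc
    obtain ⟨l, hl', rfl⟩ := List.mem_map.1 hc
    exact ⟨_, List.mem_map_of_mem hl', hl l⟩

theorem mem_flatten_varLists {L : List (List Literal)} {F : CNF} (hL : Represents L F) (v : ℕ) :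
    v ∈ (varLists L).flatten ↔ v ∈ F.vars := by
  rw [List.mem_flatten, CNF.vars, Finset.mem_biUnion]
  constructor
  · rintro ⟨S, hS, hv⟩
    obtain ⟨c, hc, h⟩ := (mem_varLists hL).1 S hS
    exact ⟨c, hc, (h v).1 hv⟩
  · rintro ⟨c, hc, hv⟩
    obtain ⟨S, hS, h⟩ := (mem_varLists hL).2 c hc
    exact ⟨S, hS, (h v).2 hv⟩

theorem witnessesLeftConvexity_convexOrdering {L : List (List Literal)} {F : CNF}
    (hL : Represents L F) (hF : F.VariableConvex) :
    WitnessesLeftConvexity (convexOrdering (varLists L)) F.inc := by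
  obtain ⟨τ, hτ⟩ := hF
  have hmem := mem_flatten_varLists hL
  have hc : IsConvexOrder (varLists L) (Precedes τ) := by
    refine ⟨fun h h' => lt_asymm h h', fun {a b} ha _ hab => ?_,
      fun {S a b c} hS ha hb hc h₁ h₂ => ?_⟩
    · refine Nat.lt_or_gt_of_ne fun e => hab ?_
      refine (List.idxOf_inj ?_).1 e
      rw [← List.mem_toFinset, hτ.1.2]
      exact (hmem a).1 ha
    · obtain ⟨d, hd, h⟩ := (mem_varLists hL).1 S hS
      exact (h c).2 (CNF.convex hτ hd ((h a).1 ha) ((h b).1 hb) ((hmem c).1 hc) h₁ h₂)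
  obtain ⟨h₁, h₂, h₃⟩ := convexOrdering_spec hc
  refine ⟨⟨h₁, ?_⟩, fun d hd v _ v'' hv'' v' _ hv hv' hp hp' => ⟨hv'', hd, ?_⟩⟩
  · ext v
    rw [List.mem_toFinset, h₂, hmem]
    rfl
  · obtain ⟨S, hS, h⟩ := (mem_varLists hL).2 d hd
    exact (h v'').1 (h₃ S hS v ((h v).2 hv.2.2) v' ((h v').2 hv'.2.2) v'' ((hmem v'').2 hv'')
      hp hp')

/-! ### The ordering is computed in polynomial time -/

open PolyTime

theorem codeSize_filter_add_filter_not {α : Type*} [Coded α] (f : α → Bool) (l : List α) :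
    codeSize (l.filter f) + codeSize (l.filter fun a => !f a) = codeSize l + 1 := by
  induction l with
  | nil => rfl
  | cons a l ih =>
    cases h : f a <;> simp [h, codeSize_cons] <;> omega

theorem codeSize_flatten_filter_add_le {α : Type*} [Coded α] (f : List α → Bool)
    (l : List (List α)) :
    codeSize (l.filter f).flatten + codeSize (l.filter fun a => !f a) ≤ codeSize l + 1 := by
  induction l with
  | nil => simp [codeSize_nil]
  | cons a l ih =>
    by_cases h : f a
    · have := codeSize_append a (l.filter f).flatten
      simp only [List.filter_cons, h, Bool.not_true, codeSize_cons, if_true, List.flatten_cons]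
      simp
      omega
    · simp only [List.filter_cons, h, codeSize_cons] at *
      simp [codeSize_cons]
      omega

variable {γ : Type*} [Coded γ]

theorem polyTime_mem_pairs {f : γ → ℕ × ℕ} {l : γ → List (ℕ × ℕ)} (hf : PolyTime f)
    (hl : PolyTime l) : PolyTime fun c => decide (f c ∈ l c) := by
  convert decide_mem (decide_eq_pair id.fst id.snd) hf hl

theorem polyTime_mem_nat {f : γ → ℕ} {l : γ → List ℕ} (hf : PolyTime f)
    (hl : PolyTime l) : PolyTime fun c => decide (f c ∈ l c) :=
  decide_mem (decide_eq_nat id.fst id.snd) hf hl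

/-- The classes grow in total size by at most a constant and the sizes of the ends of the edge. -/
theorem polyTime_foldl_merge {E : γ → List ((ℕ × ℕ) × (ℕ × ℕ))} (hE : PolyTime E) :
    PolyTime fun c => (E c).foldl merge [] := by
  have ht : PolyTime fun p : ((γ × List (List (ℕ × ℕ))) × (ℕ × ℕ) × (ℕ × ℕ)) × List (ℕ × ℕ) =>
      decide (p.1.2.1 ∈ p.2) || decide (p.1.2.2 ∈ p.2) :=
    (polyTime_mem_pairs id.fst.snd.fst id.snd).or (polyTime_mem_pairs id.fst.snd.snd id.snd)
  refine hE.foldl (i := fun _ => []) (g := fun _ => merge) nil ?_ (.X + 3) ?_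
  · exact (id.snd.fst.cons (id.snd.snd.cons (id.fst.snd.filter ht).flatten)).cons
      (id.fst.snd.filter ht.not)
  · rintro c s ⟨p, q⟩
    have := codeSize_flatten_filter_add_le (fun C => decide (p ∈ C) || decide (q ∈ C)) s
    simp only [merge, codeSize_cons, codeSize_pair, Polynomial.eval_add, Polynomial.eval_X,
      Polynomial.eval_ofNat]
    omega

theorem polyTime_sameClass {Cs : γ → List (List (ℕ × ℕ))} {p q : γ → ℕ × ℕ} (hC : PolyTime Cs)
    (hp : PolyTime p) (hq : PolyTime q) : PolyTime fun c => sameClass (Cs c) (p c) (q c) :=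
  (decide_eq_pair hp hq).or (hC.any ((polyTime_mem_pairs (hp.comp id.fst) id.snd).and
    (polyTime_mem_pairs (hq.comp id.fst) id.snd)))

theorem polyTime_before {V : γ → List ℕ} {Cs : γ → List (List (ℕ × ℕ))} {x y : γ → ℕ}
    (hV : PolyTime V) (hC : PolyTime Cs) (hx : PolyTime x) (hy : PolyTime y) :
    PolyTime fun c => before (V c) (sameClass (Cs c)) (x c) (y c) := by
  have hpairs : PolyTime fun c => pairs (V c) :=
    hV.flatMap ((hV.comp id.fst).map (id.fst.snd.pair id.snd))
  have hf : PolyTime fun c => (pairs (V c)).filter fun p =>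
      sameClass (Cs c) p (x c, y c) || sameClass (Cs c) p (y c, x c) :=
    hpairs.filter ((polyTime_sameClass (hC.comp id.fst) id.snd
      ((hx.comp id.fst).pair (hy.comp id.fst))).or (polyTime_sameClass (hC.comp id.fst) id.snd
      ((hy.comp id.fst).pair (hx.comp id.fst))))
  convert (decide_eq_nat hx hy).not.and (hf.listCases (f := fun _ => false)
    (g := fun c p _ => sameClass (Cs c) p (x c, y c)) const_false
    (polyTime_sameClass (hC.comp id.fst) id.snd.fst
      ((hx.comp id.fst).pair (hy.comp id.fst)))) using 2 with c
  unfold before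
  congr 1
  generalize (pairs (V c)).filter _ = l
  cases l <;> rfl

theorem polyTime_foldl_insertBy {V : γ → List ℕ} {r : γ → ℕ → ℕ → Bool} (hV : PolyTime V)
    (hr : PolyTime fun p : γ × ℕ × ℕ => r p.1 p.2.1 p.2.2) :
    PolyTime fun c => (V c).foldl (insertBy (r c)) [] := by
  have hr' : PolyTime fun p : ((γ × List ℕ) × ℕ) × ℕ => r p.1.1.1 p.2 p.1.2 :=
    hr.comp (id.fst.fst.fst.pair (id.snd.pair id.fst.snd))
  refine hV.foldl (i := fun _ => []) (g := fun c => insertBy (r c)) nil ?_ (.X + 1) ?_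
  · exact (polyTime_mem_nat id.snd id.fst.snd).ite id.fst.snd
      ((id.fst.snd.filter hr').append (id.snd.cons (id.fst.snd.filter hr'.not)))
  · intro c s x
    simp only [insertBy, codeSize_pair, Polynomial.eval_add, Polynomial.eval_X,
      Polynomial.eval_one]
    split
    · omega
    · have h₁ := codeSize_append (s.filter fun y => r c y x) (x :: s.filter fun y => !r c y x)
      have h₂ := codeSize_filter_add_filter_not (fun y => r c y x) s
      rw [codeSize_cons] at h₁
      omega

theorem polyTime_edges {L : γ → List (List ℕ)} (hL : PolyTime L) :
    PolyTime fun c => edges (L c) := by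
  refine hL.flatMap (id.snd.flatMap (id.fst.snd.flatMap
    (PolyTime.flatMap (γ := ((γ × List ℕ) × ℕ) × ℕ)
      (l := fun p => (L p.1.1.1).flatten.filter fun c => !decide (c ∈ p.1.1.2))
      (f := fun p c => [((p.1.2, c), (p.2, c)), ((c, p.1.2), (c, p.2))]) ?_ ?_)))
  · exact (hL.comp id.fst.fst.fst).flatten.filter (polyTime_mem_nat id.snd id.fst.fst.fst.snd).not
  · exact ((id.fst.fst.snd.pair id.snd).pair (id.fst.snd.pair id.snd)).cons
      (((id.snd.pair id.fst.fst.snd).pair (id.snd.pair id.fst.snd)).cons nil)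

theorem polyTime_convexOrdering : PolyTime fun L : List (List ℕ) => convexOrdering L := by
  have hC : PolyTime fun L : List (List ℕ) => (edges L).foldl merge [] :=
    polyTime_foldl_merge (polyTime_edges id)
  exact polyTime_foldl_insertBy id.flatten
    (polyTime_before id.fst.flatten (hC.comp id.fst) id.snd.fst id.snd.snd)

theorem polyTimeOrdering_variableConvex :
    PolyTimeOrdering {F : CNF | F.VariableConvex} fun F σ => WitnessesLeftConvexity σ F.inc := by
  have hv : PolyTime varLists := id.map (id.snd.map id.snd.fst)
  obtain ⟨P, q, h⟩ := polyTime_convexOrdering.comp hv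
  refine ⟨P, q, fun F hF L hL => ?_⟩
  obtain ⟨t, ht, hq⟩ := h L
  exact ⟨_, t, witnessesLeftConvexity_convexOrdering hL hF, ht, hq⟩

end FewSubterms

theorem mainTheorem3 :
    HasConstructiveFewSubterms {F : CNF | F.VariableConvex} ∧
    (∀ (F : CNF) (σ : List ℕ), WitnessesLeftConvexity σ F.inc →
      ∀ j : ℕ, 0 < j → j ≤ σ.length →
        (F.subterms (σ.take j).toFinset).ncard ≤ 2 * (F.size + 1)) ∧
    PolyTimeOrdering {F : CNF | F.VariableConvex}
      (fun F σ => WitnessesLeftConvexity σ F.inc) := by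
  refine ⟨⟨2 * (.X + 1), fun F ⟨σ, hσ⟩ => ?_, ?_⟩,
    fun F σ h j _ _ => CNF.ncard_subterms_le h j, polyTimeOrdering_variableConvex⟩
  · simpa using (CNF.subtermWidth_le hσ.1).trans (CNF.stw_le hσ)
  · obtain ⟨P, q, h⟩ := polyTimeOrdering_variableConvex
    refine ⟨P, q, fun F hF L hL => ?_⟩
    obtain ⟨σ, t, hσ, ht⟩ := h F hF L hL
    exact ⟨σ, t, ⟨hσ.1, by simpa using CNF.stw_le hσ⟩, ht⟩
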